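/- A partial group is a simplicial set $\mathbb M$ with exactly one vertex $v$, whose spine operators $\mathbb M_n\to(\mathbb M_1)^n$ are injective for $n\ge 1$ (a simplex with spine $(x_1,\dots,x_n)$ is written $[x_1|\dots|x_n]$; $\Pi[x_1|\dots|x_n]=x_1\cdots x_n\in\mathbb M_1$ is its edge joining the first and last vertices, and $1=s_0(v)$), and which has an inversion: an anti-involution $\mathbf u\mapsto \mathbf u^{-1}$ (a simplicial map $\nu:\mathbb M\to\mathbb M^{\mathrm{op}}$ with $\nu^{-1}=\nu^{\mathrm{op}}$) such that for every $\mathbf u\in\mathbb M_n$, $n\ge1$, there is a simplex $[\mathbf u^{-1}|\mathbf u]\in \mathbb M_{2n}$ and $\Pi[\mathbf u^{-1}|\mathbf u]=1$. Homomorphisms of partial groups are simplicial maps; $B\operatorname{Aut}(\mathbb M)$ is the bar construction of the group of automorphisms of $\mathbb M$ under composition. Let $\mathbb M,\mathbb H$ be partial groups. An extension $\mathbb M\xrightarrow{\iota}\mathbb E\xrightarrow{\tau}\mathbb H$ is a fibre bundle $\tau$ with fibre $\mathbb M$ (a surjective simplicial map whose pullback along each simplex $\Delta[n]\to\mathbb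 H$ is isomorphic to $\mathbb M\times\Delta[n]$ over $\Delta[n]$) together with a map $\iota$ identifying $\mathbb M$ with the fibre of $\tau$ over the vertex of $\mathbb H$. A section $\sigma:\mathbb H\to\mathbb E$ of $\tau$ is regular if each edge $\eta$ of each simplex in its image determines a homotopy of $\iota$, that is, there is a simplicial map $F:\mathbb M\times\Delta[1]\to\mathbb E$ which restricts to $\iota$ on $\mathbb M\times\{v_1\}$, where $v_1$ is the final vertex of $\Delta[1]$, and takes the value $\eta$ at the pair formed by $1$ and the non-degenerate edge of $\Delta[1]$. For a homomorphism $\rho:\mathbb H\to B\operatorname{Aut}(\mathbb M)$, the semidirect product $\mathbb M\rtimes_\rho\mathbb H$ is the partial group with $n$-simplices $[(x_1,g_1)|\dots|(x_n,g_n)]$ such that $[g_1|\dots|g_n]\in\mathbb H_n$ and $[x_1|\rho(g_1)(x_2)|\dots|\rho(g_1\cdots g_{n-1})(x_n)]\in\mathbb M_n$, and with product $(x_1,g_1)\cdot(x_2,g_2)=(x_1\cdot\rho(g_1)(x_2),\,g_1\cdot g_2)$; it has the inclusion $\iota_0(x)=(x,1)$ of $\mathbb M$, the projection $\tau_0$ to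 $\mathbb H$, and the canonical section $\sigma_0[g_1|\dots|g_n]=[(1,g_1)|\dots|(1,g_n)]$ of $\tau_0$. **Lemma.** Let $\mathbb M\xrightarrow{\iota}\mathbb E\xrightarrow{\tau}\mathbb H$ be an extension of partial groups and let $\sigma$ be a regular section of $\tau$. Then $\sigma$ determines a homomorphism of partial groups $\rho:\mathbb H\to B\operatorname{Aut}(\mathbb M)$ and an isomorphism of regular split extensions $\varphi:\mathbb M\rtimes_\rho\mathbb H\to\mathbb E$. That is: there are a homomorphism $\rho$ and an isomorphism $\varphi$ with $\varphi\circ\iota_0=\iota$, $\tau\circ\varphi=\tau_0$ and $\varphi\circ\sigma_0=\sigma$; the homomorphism $\rho$ for which such a $\varphi$ exists is unique, and so is $\varphi$; and $\mathbb M\xrightarrow{\iota_0}\mathbb M\rtimes_\rho\mathbb H\xrightarrow{\tau_0}\mathbb H$ is itself an extension with regular section $\sigma_0$. -/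

import Mathlib

open CategoryTheory MonoidalCategory CartesianMonoidalCategory Simplicial Opposite

universe u

namespace PartialGroups

noncomputable section

/-! ### Partial monoids and partial groups -/

/-- The `i`-th edge `e_{i+1} : X_n → X_1`, induced by `[1] → [n]` with image `{i, i+1}`
(edges are numbered from `0`). -/
def edge {X : SSet.{u}} {n : ℕ} (i : Fin n) (x : X _⦋n⦌) : X _⦋1⦌ :=
  X.map (SimplexCategory.mkOfSucc i).op x

/-- The spine operator `X_n → (X_1)^n`. -/
def spine {X : SSet.{u}} {n : ℕ} (x : X _⦋n⦌) : Fin n → X _⦋1⦌ := fun i => edge i x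

/-- The product (back edge) operator `Π : X_n → X_1`, induced by `[1] → [n]` with image `{0, n}`. -/
def prodOp {X : SSet.{u}} {n : ℕ} (x : X _⦋n⦌) : X _⦋1⦌ :=
  X.map (SimplexCategory.diag n).op x

/-- A partial monoid: a simplicial set with exactly one vertex and injective spine operators. -/
class IsPartialMonoid (M : SSet.{u}) : Prop where
  reduced : ∃! _v : M _⦋0⦌, True
  spine_injective : ∀ n : ℕ, 1 ≤ n → Function.Injective (spine : M _⦋n⦌ → Fin n → M _⦋1⦌)

/-- The unique vertex. -/
def vertex (M : SSet.{u}) [IsPartialMonoid M] : M _⦋0⦌ :=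
  (IsPartialMonoid.reduced (M := M)).choose

theorem eq_vertex {M : SSet.{u}} [IsPartialMonoid M] (v : M _⦋0⦌) : v = vertex M :=
  (IsPartialMonoid.reduced (M := M)).choose_spec.2 v trivial

/-- The unit `1 = s_0(v)`. -/
def unit (M : SSet.{u}) [IsPartialMonoid M] : M _⦋1⦌ := M.σ 0 (vertex M)

/-- An inversion: a simplicial map `ν : M → M^op` with inverse `ν^op`, such that for each
`n`-simplex `u`, `n ≥ 1`, there is a simplex `[ν(u)|u]`, of dimension `2n`, and
`Π[ν(u)|u] = 1`. -/
structure Inversion (M : SSet.{u}) [IsPartialMonoid M] where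
  ν : M ⟶ M.op
  involutive : ∀ {n : SimplexCategoryᵒᵖ} (x : M.obj n),
    SSet.opObjEquiv (ν.app n (SSet.opObjEquiv (ν.app n x))) = x
  inv_mul : ∀ n : ℕ, 1 ≤ n → ∀ u : M _⦋n⦌, ∃ w : M _⦋n + n⦌,
    spine w = Fin.append (spine (SSet.opObjEquiv (ν.app _ u) : M _⦋n⦌)) (spine u) ∧
      prodOp w = unit M

/-- A partial group is a partial monoid with an inversion (which is then unique). Homomorphisms of
partial groups are simplicial maps. -/
class IsPartialGroup (M : SSet.{u}) : Prop extends IsPartialMonoid M where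
  inversion : Nonempty (Inversion M)

/-! ### Fibre bundles and extensions -/

/-- `f : E → B` is a fibre bundle with fibre `F`: it is surjective, and for each simplex
`b : Δ[n] → B` the pullback of `f` along `b` is isomorphic, over `Δ[n]`, to `F × Δ[n]`. -/
structure IsFibreBundle (F : SSet.{u}) {E B : SSet.{u}} (f : E ⟶ B) : Prop where
  surjective : ∀ n : SimplexCategoryᵒᵖ, Function.Surjective (f.app n)
  locally_trivial : ∀ (n : ℕ) (b : (Δ[n] : SSet.{u}) ⟶ B),
    ∃ t : F ⊗ (Δ[n] : SSet.{u}) ⟶ E, IsPullback t (snd F Δ[n]) f b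

/-- An extension `M → E → H` of partial groups: `τ` is a fibre bundle with fibre `M`, and `ι`
identifies `M` with the fibre of `τ` over the vertex of `H`. -/
structure IsExtension {M E H : SSet.{u}} [IsPartialGroup M] [IsPartialGroup H]
    (ι : M ⟶ E) (τ : E ⟶ H) : Prop where
  bundle : IsFibreBundle M τ
  fibre : IsPullback ι (SSet.stdSimplex.isTerminalObj₀.from M) τ
    (SSet.yonedaEquiv.symm (vertex H) : (Δ[0] : SSet.{u}) ⟶ H)

/-! ### Homotopies and normalizers -/

/-- `η` determines a homotopy from `g` to `f`: there is `F : X × Δ[1] → Y` with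
`F ∘ (Id × v₀) = f`, `F ∘ (Id × v₁) = g` and `F(1, ι) = η`, where `ι` is the non-degenerate edge
of `Δ[1]`. -/
def DefinesHomotopy {X Y : SSet.{u}} [IsPartialMonoid X] (η : Y _⦋1⦌) (f g : X ⟶ Y) : Prop :=
  ∃ F : X ⊗ (Δ[1] : SSet.{u}) ⟶ Y, SSet.ι₀ ≫ F = f ∧ SSet.ι₁ ≫ F = g ∧
    F.app (op ⦋1⦌) (unit X, SSet.stdSimplex.objEquiv.symm (𝟙 ⦋1⦌)) = η

/-- The `n`-simplices of `N_E(M)`: those simplices `[η₁|…|ηₙ]` of `E` such that each `ηᵢ`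
determines a homotopy from the inclusion `ι : M → E` to some map. -/
def normalizer {M E : SSet.{u}} [IsPartialMonoid M] (ι : M ⟶ E) (n : ℕ) : Set (E _⦋n⦌) :=
  {x | ∀ i : Fin n, ∃ f : M ⟶ E, DefinesHomotopy (edge i x) f ι}

/-- `M → E → H` is an extension, and `σ` is a regular section of it: a section with image in
`N_E(M)`. -/
structure IsRegularSplitExtension {M E H : SSet.{u}} [IsPartialGroup M] [IsPartialGroup H]
    (ι : M ⟶ E) (τ : E ⟶ H) (σ : H ⟶ E) : Prop where
  extension : IsExtension ι τ
  isSection : σ ≫ τ = 𝟙 H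
  regular : ∀ (n : ℕ) (h : H _⦋n⦌), σ.app _ h ∈ normalizer ι n

/-! ### Actions and semidirect products -/

/-- The bar construction `BG`. In `SingleObj Gᵐᵒᵖ` the composite of `g` followed by `h` is
`g * h`, so that `Π[g₁|…|gₙ] = g₁ ⋯ gₙ`. -/
abbrev bar (G : Type u) [Group G] : SSet.{u} := nerve (SingleObj Gᵐᵒᵖ)

/-- The product `g_{i+1} ⋯ g_j` for the simplex `[g₁|…|gₙ]` of `BG`. -/
def barProd {G : Type u} [Group G] {n : SimplexCategoryᵒᵖ} (s : (bar G).obj n)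
    {i j : Fin (n.unop.len + 1)} (h : i ≤ j) : G :=
  MulOpposite.unop (CategoryTheory.Functor.map (C := Fin (n.unop.len + 1)) (D := SingleObj Gᵐᵒᵖ) s (homOfLE h))

theorem barProd_self {G : Type u} [Group G] {n : SimplexCategoryᵒᵖ} (s : (bar G).obj n)
    (i : Fin (n.unop.len + 1)) : barProd s (le_refl i) = 1 :=
  congrArg MulOpposite.unop
    (CategoryTheory.Functor.map_id (C := Fin (n.unop.len + 1)) (D := SingleObj Gᵐᵒᵖ) s i)

theorem barProd_mul {G : Type u} [Group G] {n : SimplexCategoryᵒᵖ} (s : (bar G).obj n)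
    {i j k : Fin (n.unop.len + 1)} (h : i ≤ j) (h' : j ≤ k) :
    barProd s h * barProd s h' = barProd s (h.trans h') :=
  (congrArg MulOpposite.unop
    (CategoryTheory.Functor.map_comp (C := Fin (n.unop.len + 1)) (D := SingleObj Gᵐᵒᵖ) s
      (homOfLE h) (homOfLE h'))).symm

theorem barProd_map {G : Type u} [Group G] {n m : SimplexCategoryᵒᵖ} (s : (bar G).obj n)
    (θ : n ⟶ m) {i j : Fin (m.unop.len + 1)} (h : i ≤ j) :
    barProd ((bar G).map θ s) h = barProd s (θ.unop.toOrderHom.monotone h) :=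
  rfl

section Semidirect

variable {M H : SSet.{u}} (ρ : H ⟶ bar (Aut M))

/-- For `b = [g₁|…|gₙ]` in `H`, the automorphism `ρ(g₁ ⋯ g_k)` of `M`. -/
def actProd {n : SimplexCategoryᵒᵖ} (b : H.obj n) (k : Fin (n.unop.len + 1)) : Aut M :=
  barProd (ρ.app n b) (Fin.zero_le k)

theorem actProd_zero {n : SimplexCategoryᵒᵖ} (b : H.obj n) : actProd ρ b 0 = 1 :=
  barProd_self _ _

theorem actProd_map {n m : SimplexCategoryᵒᵖ} (θ : n ⟶ m) (b : H.obj n)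
    (k : Fin (m.unop.len + 1)) :
    actProd ρ b (θ.unop.toOrderHom 0) * actProd ρ (H.map θ b) k =
      actProd ρ b (θ.unop.toOrderHom k) := by
  have e : ρ.app m (H.map θ b) = (bar (Aut M)).map θ (ρ.app n b) :=
    ConcreteCategory.congr_hom (ρ.naturality θ) b
  simp only [actProd, e, barProd_map]
  exact barProd_mul _ _ _

/-- The semidirect product `M ⋊_ρ H`, that is, the twisted cartesian product of the twisting pair
`(ρ, 1)`. Its `n`-simplices are pairs `(x, b)` in `M_n × H_n`, with
`d₀(x, b) = (ρ(g₁)⁻¹ d₀ x, d₀ b)` for `b = [g₁|…|gₙ]`, the other faces and the degeneracies being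
componentwise. The edges of the simplex `(x, b)` with `x = [y₁|…|yₙ]` are the pairs `(xᵢ, gᵢ)`
with `yᵢ = ρ(g₁ ⋯ g_{i-1})(xᵢ)`, and `(x₁, g₁) ⬝ (x₂, g₂) = (x₁ ⬝ ρ(g₁)(x₂), g₁ ⬝ g₂)`. -/
def semidirect : SSet.{u} where
  obj n := M.obj n × H.obj n
  map {n m} θ := ↾fun p =>
    ((actProd ρ p.2 (θ.unop.toOrderHom 0)).inv.app m (M.map θ p.1), H.map θ p.2)
  map_id n := by
    ext p
    · have h : actProd ρ p.2 ((𝟙 n : n ⟶ n).unop.toOrderHom 0) = 1 := actProd_zero ρ p.2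
      change (actProd ρ p.2 ((𝟙 n : n ⟶ n).unop.toOrderHom 0)).inv.app n (M.map (𝟙 n) p.1) = p.1
      rw [h, CategoryTheory.Functor.map_id]
      rfl
    · change H.map (𝟙 n) p.2 = p.2
      rw [CategoryTheory.Functor.map_id]
      rfl
  map_comp {n m l} θ ψ := by
    ext p
    · have h := actProd_map ρ θ p.2 (ψ.unop.toOrderHom 0)
      change (actProd ρ p.2 (θ.unop.toOrderHom (ψ.unop.toOrderHom 0))).inv.app l
          (M.map (θ ≫ ψ) p.1) =
        (actProd ρ (H.map θ p.2) (ψ.unop.toOrderHom 0)).inv.app l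
          (M.map ψ ((actProd ρ p.2 (θ.unop.toOrderHom 0)).inv.app m (M.map θ p.1)))
      have e : M.map ψ ((actProd ρ p.2 (θ.unop.toOrderHom 0)).inv.app m (M.map θ p.1)) =
          (actProd ρ p.2 (θ.unop.toOrderHom 0)).inv.app l (M.map ψ (M.map θ p.1)) :=
        (ConcreteCategory.congr_hom
          ((actProd ρ p.2 (θ.unop.toOrderHom 0)).inv.naturality ψ) (M.map θ p.1)).symm
      rw [e, ← h, CategoryTheory.Functor.map_comp]
      rfl
    · change H.map (θ ≫ ψ) p.2 = H.map ψ (H.map θ p.2)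
      rw [CategoryTheory.Functor.map_comp]
      rfl

/-- The projection `M ⋊_ρ H → H`. -/
def semidirectProj : semidirect ρ ⟶ H where
  app _ := ↾fun p => p.2
  naturality _ _ _ := rfl

theorem actProd_const {n : SimplexCategoryᵒᵖ} (v : H _⦋0⦌) (k : Fin (n.unop.len + 1)) :
    actProd ρ (H.map (n.unop.const ⦋0⦌ 0).op v) k = 1 := by
  have h := actProd_map ρ (n.unop.const ⦋0⦌ 0).op v k
  have h0 : ∀ j : Fin ((op ⦋0⦌).unop.len + 1), actProd ρ v j = 1 := by
    intro j
    obtain rfl : j = 0 := Subsingleton.elim (α := Fin 1) _ _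
    exact actProd_zero ρ v
  rwa [h0, h0, one_mul] at h

/-- The inclusion `M → M ⋊_ρ H`, `x ↦ (x, 1)`. -/
def semidirectIncl [IsPartialMonoid H] : M ⟶ semidirect ρ where
  app n := ↾fun x => (x, H.map (n.unop.const ⦋0⦌ 0).op (vertex H))
  naturality n m θ := by
    ext x
    refine Prod.ext ?_ ?_
    · change M.map θ x =
        (actProd ρ (H.map (n.unop.const ⦋0⦌ 0).op (vertex H)) (θ.unop.toOrderHom 0)).inv.app m
          (M.map θ x)
      rw [actProd_const]
      rfl
    · change H.map (m.unop.const ⦋0⦌ 0).op (vertex H) =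
        H.map θ (H.map (n.unop.const ⦋0⦌ 0).op (vertex H))
      rw [← CategoryTheory.comp_apply, ← CategoryTheory.Functor.map_comp]
      rfl

/-- The canonical section `[g₁|…|gₙ] ↦ [(1, g₁)|…|(1, gₙ)]` of `M ⋊_ρ H → H`. -/
def semidirectSection [IsPartialMonoid M] : H ⟶ semidirect ρ where
  app n := ↾fun b => (M.map (n.unop.const ⦋0⦌ 0).op (vertex M), b)
  naturality n m θ := by
    ext b
    refine Prod.ext ?_ ?_
    · change M.map (m.unop.const ⦋0⦌ 0).op (vertex M) =
        (actProd ρ b (θ.unop.toOrderHom 0)).inv.app m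
          (M.map θ (M.map (n.unop.const ⦋0⦌ 0).op (vertex M)))
      have e : M.map θ (M.map (n.unop.const ⦋0⦌ 0).op (vertex M)) =
          M.map (m.unop.const ⦋0⦌ 0).op (vertex M) := by
        rw [← CategoryTheory.comp_apply, ← CategoryTheory.Functor.map_comp]
        rfl
      rw [e]
      have e' := ConcreteCategory.congr_hom
        ((actProd ρ b (θ.unop.toOrderHom 0)).inv.naturality (m.unop.const ⦋0⦌ 0).op) (vertex M)
      refine Eq.trans ?_ e'.symm
      change _ = M.map (m.unop.const ⦋0⦌ 0).op
        ((actProd ρ b (θ.unop.toOrderHom 0)).inv.app _ (vertex M))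
      exact congrArg (M.map (m.unop.const ⦋0⦌ 0).op) (eq_vertex _).symm
    · rfl

end Semidirect

/-- `φ : E₁ ≅ E₂` is an isomorphism of split extensions `M → Eᵢ → H` with sections `σᵢ`: it is
the identity on `M` and on `H`, and carries `σ₁` to `σ₂`. -/
structure IsSplitExtensionIso {M E₁ E₂ H : SSet.{u}} (ι₁ : M ⟶ E₁) (τ₁ : E₁ ⟶ H) (σ₁ : H ⟶ E₁)
    (ι₂ : M ⟶ E₂) (τ₂ : E₂ ⟶ H) (σ₂ : H ⟶ E₂) (φ : E₁ ≅ E₂) : Prop where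
  incl : ι₁ ≫ φ.hom = ι₂
  proj : φ.hom ≫ τ₂ = τ₁
  sect : σ₁ ≫ φ.hom = σ₂

end

end PartialGroups

/-! The action is conjugation by the section. A homotopy `F` ending at `ι` with value `σ(g)` at the
edge of `Δ[1]` over `1` has restriction `ι ∘ ρ(g)` to the initial vertex, and the two triangles of
each square in `M × Δ[1]` give `ρ(g)(x) · σ(g) = σ(g) · x` in `E`.

The engine is rigidity (`prod_hom_ext`): a map from `M × Δ[n]` to a partial monoid with cancellation
is determined by its restriction to one vertex of `Δ[n]` and its value at the nondegenerate simplex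
of `{1} × Δ[n]`. Partial groups have cancellation, and so has `E`: simplices over a common base
simplex can be compared in `M` by a local trivialization.

For each simplex `b` of `H`, the homotopies given by regularity for the edges of `b` are read in a
trivialization over `b` and composed, giving a map `M × Δ[n] → E` which is `ι` at the last vertex
and takes the value `σ(b)` (`exists_transport`). By rigidity this map is unique, hence compatible
with faces and degeneracies (`transport_map`). Its restrictions to vertices are therefore
multiplicative, and are invertible because edges of `H` have inverses. They define `ρ`. Once they
are invertible, homotopy reversal (`ap_bijective_of_homotopy`) makes the map itself a
trivialization, so the comparison `M ⋊ H → E` is bijective.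

Uniqueness is rigidity again: a morphism from `M ⋊ H` compatible with inclusion and section has
prescribed values on every `M × Δ[n]` (`semidirectTransport_comp`). The semidirect product inherits
the extension and regularity properties along the isomorphism. -/

namespace PartialGroups

noncomputable section

/-! ### Edges and products -/

/-- The edge of `x` joining the vertices `i` and `j`. -/
def ed {X : SSet.{u}} {n : ℕ} (x : X _⦋n⦌) (i j : Fin (n + 1)) (h : i ≤ j) : X _⦋1⦌ :=
  X.map (SimplexCategory.mkOfLe i j h).op x

/-- There is a `2`-simplex with spine `(a, b)` and product `c`. -/
def Triple {X : SSet.{u}} (a b c : X _⦋1⦌) : Prop :=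
  ∃ w : X _⦋2⦌, ed w 0 1 (by decide) = a ∧ ed w 1 2 (by decide) = b ∧ ed w 0 2 (by decide) = c

theorem edge_eq_ed {X : SSet.{u}} {n : ℕ} (i : Fin n) (x : X _⦋n⦌) :
    edge i x = ed x i.castSucc i.succ (Fin.castSucc_le_succ i) := by
  rfl

theorem mkOfLe_comp {n m : ℕ} (θ : ⦋n⦌ ⟶ ⦋m⦌) (i j : Fin (n + 1)) (h : i ≤ j) :
    SimplexCategory.mkOfLe i j h ≫ θ =
      SimplexCategory.mkOfLe (θ.toOrderHom i) (θ.toOrderHom j) (θ.toOrderHom.monotone h) := by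
  ext k
  fin_cases k <;> rfl

theorem ed_map {X : SSet.{u}} {n m : ℕ} (θ : ⦋n⦌ ⟶ ⦋m⦌) (x : X _⦋m⦌) (i j : Fin (n + 1))
    (h : i ≤ j) : ed (X.map θ.op x) i j h =
      ed x (θ.toOrderHom i) (θ.toOrderHom j) (θ.toOrderHom.monotone h) := by
  unfold ed
  rw [← mkOfLe_comp, op_comp, Functor.map_comp]
  rfl

theorem ed_zero_one {X : SSet.{u}} (x : X _⦋1⦌) : ed x 0 1 (by decide) = x := by
  have : SimplexCategory.mkOfLe (n := 1) 0 1 (by decide) = 𝟙 _ := by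
    ext k
    fin_cases k <;> rfl
  simp [ed, this]

theorem app_map {X Y : SSet.{u}} (f : X ⟶ Y) {n m : SimplexCategoryᵒᵖ} (θ : n ⟶ m)
    (x : X.obj n) : f.app m (X.map θ x) = Y.map θ (f.app n x) :=
  ConcreteCategory.congr_hom (f.naturality θ) x

theorem app_ed {X Y : SSet.{u}} (f : X ⟶ Y) {n : ℕ} (x : X _⦋n⦌) (i j : Fin (n + 1))
    (h : i ≤ j) : f.app _ (ed x i j h) = ed (f.app _ x) i j h :=
  ConcreteCategory.congr_hom (f.naturality (SimplexCategory.mkOfLe i j h).op) x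

theorem Triple.map {X Y : SSet.{u}} (f : X ⟶ Y) {a b c : X _⦋1⦌} (h : Triple a b c) :
    Triple (f.app _ a) (f.app _ b) (f.app _ c) := by
  obtain ⟨w, rfl, rfl, rfl⟩ := h
  exact ⟨f.app _ w, (app_ed ..).symm, (app_ed ..).symm, (app_ed ..).symm⟩

theorem triple_ed {X : SSet.{u}} {n : ℕ} (x : X _⦋n⦌) (i j k : Fin (n + 1)) (h : i ≤ j)
    (h' : j ≤ k) : Triple (ed x i j h) (ed x j k h') (ed x i k (h.trans h')) :=
  ⟨X.map (SimplexCategory.mkOfLeComp i j k h h').op x, ed_map .., ed_map .., ed_map ..⟩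

/-! ### Degenerate simplices at the vertex -/

/-- The `n`-simplex `[1|…|1]`. -/
def oneSimplex (M : SSet.{u}) [IsPartialMonoid M] (n : SimplexCategoryᵒᵖ) : M.obj n :=
  M.map (n.unop.const ⦋0⦌ 0).op (vertex M)

theorem map_const {X : SSet.{u}} {n m : SimplexCategoryᵒᵖ} (θ : n ⟶ m) (v : X _⦋0⦌) :
    X.map θ (X.map (n.unop.const ⦋0⦌ 0).op v) = X.map (m.unop.const ⦋0⦌ 0).op v := by
  rw [← CategoryTheory.comp_apply, ← CategoryTheory.Functor.map_comp]
  rfl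

theorem map_oneSimplex {M : SSet.{u}} [IsPartialMonoid M] {n m : SimplexCategoryᵒᵖ} (θ : n ⟶ m) :
    M.map θ (oneSimplex M n) = oneSimplex M m :=
  map_const _ _

theorem app_oneSimplex {M N : SSet.{u}} [IsPartialMonoid M] [IsPartialMonoid N] (f : M ⟶ N)
    (n : SimplexCategoryᵒᵖ) : f.app n (oneSimplex M n) = oneSimplex N n :=
  (ConcreteCategory.congr_hom (f.naturality (n.unop.const ⦋0⦌ 0).op) (vertex M)).trans
    (congrArg (N.map (n.unop.const ⦋0⦌ 0).op) (eq_vertex _))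

theorem map_const_eq_oneSimplex {M : SSet.{u}} [IsPartialMonoid M] {n : SimplexCategoryᵒᵖ}
    (v : M _⦋0⦌) : M.map (n.unop.const ⦋0⦌ 0).op v = oneSimplex M n :=
  congrArg (M.map (n.unop.const ⦋0⦌ 0).op) (eq_vertex v)

theorem unit_eq_oneSimplex (M : SSet.{u}) [IsPartialMonoid M] : unit M = oneSimplex M (op ⦋1⦌) := by
  unfold unit oneSimplex SimplicialObject.σ
  congr 3
  exact Subsingleton.elim _ _

theorem ed_self {M : SSet.{u}} [IsPartialMonoid M] {n : ℕ} (x : M _⦋n⦌) (i : Fin (n + 1)) :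
    ed x i i le_rfl = unit M := by
  have : SimplexCategory.mkOfLe i i le_rfl =
      SimplexCategory.const ⦋1⦌ ⦋0⦌ 0 ≫ SimplexCategory.const ⦋0⦌ ⦋n⦌ i := by
    ext k
    fin_cases k <;> rfl
  rw [unit_eq_oneSimplex, ed, this, op_comp, Functor.map_comp, CategoryTheory.comp_apply]
  exact map_const_eq_oneSimplex (n := op ⦋1⦌) _

theorem triple_unit_left {M : SSet.{u}} [IsPartialMonoid M] (y : M _⦋1⦌) : Triple (unit M) y y := by
  simpa only [ed_self, ed_zero_one] using triple_ed y 0 0 1 (by decide) (by decide)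

theorem triple_unit_right {M : SSet.{u}} [IsPartialMonoid M] (y : M _⦋1⦌) :
    Triple y (unit M) y := by
  simpa only [ed_self, ed_zero_one] using triple_ed y 0 1 1 (by decide) (by decide)

theorem simplex_ext {M : SSet.{u}} [IsPartialMonoid M] {n : ℕ} {x y : M _⦋n⦌}
    (h : ∀ i : Fin n, edge i x = edge i y) : x = y := by
  obtain rfl | hn := Nat.eq_zero_or_pos n
  · exact (eq_vertex x).trans (eq_vertex y).symm
  · exact IsPartialMonoid.spine_injective n hn (funext h)

theorem simplex_ext_two {M : SSet.{u}} [IsPartialMonoid M] {x y : M _⦋2⦌}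
    (h : ed x 0 1 (by decide) = ed y 0 1 (by decide))
    (h' : ed x 1 2 (by decide) = ed y 1 2 (by decide)) : x = y := by
  apply simplex_ext
  intro i
  fin_cases i
  · exact h
  · exact h'

theorem hom_ext_edges {X M : SSet.{u}} [IsPartialMonoid M] {f g : X ⟶ M}
    (h : ∀ x : X _⦋1⦌, f.app _ x = g.app _ x) : f = g := by
  ext ⟨n⟩ x
  induction n using SimplexCategory.rec with | _ n =>
  apply simplex_ext
  intro i
  have hi := Fin.castSucc_le_succ i
  exact (app_ed f x _ _ hi).symm.trans ((h _).trans (app_ed g x _ _ hi))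

theorem Triple.prod_unique {M : SSet.{u}} [IsPartialMonoid M] {a b c c' : M _⦋1⦌}
    (h : Triple a b c) (h' : Triple a b c') : c = c' := by
  obtain ⟨w, rfl, rfl, rfl⟩ := h
  obtain ⟨w', h1, h2, rfl⟩ := h'
  rw [simplex_ext_two h1 h2]

/-! ### Cancellation -/

/-- A partial monoid with two-sided cancellation. -/
class IsCancellative (N : SSet.{u}) [IsPartialMonoid N] : Prop where
  left_cancel : ∀ {a b b' c : N _⦋1⦌}, Triple a b c → Triple a b' c → b = b'
  right_cancel : ∀ {a a' b c : N _⦋1⦌}, Triple a b c → Triple a' b c → a = a'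

/-- Inside one simplex, `x(yz) = (xy)z`; when `xy = 1` the right side is `z`, since products are
unique. -/
theorem left_assoc {M : SSet.{u}} [IsPartialMonoid M] {n : ℕ} (q : M _⦋n⦌) {i j k l : Fin (n + 1)}
    (hij : i ≤ j) (hjk : j ≤ k) (hkl : k ≤ l) (h : ed q i k (hij.trans hjk) = unit M) :
    Triple (ed q i j hij) (ed q j l (hjk.trans hkl)) (ed q k l hkl) := by
  have h1 := triple_ed q i k l (hij.trans hjk) hkl
  rw [h] at h1
  rw [(triple_unit_left _).prod_unique h1]
  exact triple_ed q i j l hij (hjk.trans hkl)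

theorem right_assoc {M : SSet.{u}} [IsPartialMonoid M] {n : ℕ} (q : M _⦋n⦌)
    {i j k l : Fin (n + 1)} (hij : i ≤ j) (hjk : j ≤ k) (hkl : k ≤ l)
    (h : ed q j l (hjk.trans hkl) = unit M) :
    Triple (ed q i k (hij.trans hjk)) (ed q k l hkl) (ed q i j hij) := by
  have h1 := triple_ed q i j l hij (hjk.trans hkl)
  rw [h] at h1
  rw [(triple_unit_right _).prod_unique h1]
  exact triple_ed q i k l (hij.trans hjk) hkl

namespace Inversion

variable {M : SSet.{u}} [IsPartialMonoid M] (I : Inversion M)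

/-- The inverse of a simplex. -/
def inv {n : SimplexCategoryᵒᵖ} (x : M.obj n) : M.obj n := SSet.opObjEquiv (I.ν.app n x)

theorem inv_inv {n : SimplexCategoryᵒᵖ} (x : M.obj n) : I.inv (I.inv x) = x := I.involutive x

theorem inv_map {n m : SimplexCategoryᵒᵖ} (θ : n ⟶ m) (x : M.obj n) :
    I.inv (M.map θ x) = M.map (SimplexCategory.rev.map θ.unop).op (I.inv x) :=
  ConcreteCategory.congr_hom (I.ν.naturality θ) x

theorem inv_ed {n : ℕ} (x : M _⦋n⦌) (i j : Fin (n + 1)) (h : i ≤ j) :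
    I.inv (ed x i j h) = ed (I.inv x) j.rev i.rev (Fin.rev_le_rev.2 h) := by
  have : SimplexCategory.rev.map (SimplexCategory.mkOfLe i j h) =
      SimplexCategory.mkOfLe j.rev i.rev (Fin.rev_le_rev.2 h) := by
    ext k
    fin_cases k <;> rfl
  exact (I.inv_map _ x).trans
    (congrArg (fun θ : ⦋1⦌ ⟶ ⦋n⦌ => M.map θ.op (I.inv x)) this)

theorem inv_oneSimplex (n : SimplexCategoryᵒᵖ) : I.inv (oneSimplex M n) = oneSimplex M n := by
  unfold oneSimplex
  rw [inv_map]
  refine Eq.trans (congrArg _ (eq_vertex _)) ?_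
  congr 2

theorem triple_inv_left (x : M _⦋1⦌) : Triple (I.inv x) x (unit M) := by
  obtain ⟨w, hw, hp⟩ := I.inv_mul 1 le_rfl x
  refine ⟨w, ?_, ?_, hp⟩
  · exact (congrFun hw 0).trans (ed_zero_one _)
  · exact (congrFun hw 1).trans (ed_zero_one _)

theorem triple_inv_right (x : M _⦋1⦌) : Triple x (I.inv x) (unit M) := by
  simpa only [inv_inv] using I.triple_inv_left (I.inv x)

theorem triple_left {x y z : M _⦋1⦌} (h : Triple x y z) : Triple (I.inv x) z y := by
  obtain ⟨w, rfl, rfl, rfl⟩ := h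
  -- For `w = [x|y]` this is `W = [y⁻¹|x⁻¹|x|y]`; the last three edges give `x⁻¹(xy) = y`.
  obtain ⟨W, hW, -⟩ := I.inv_mul 2 (by decide) w
  have e1 : ed W 1 2 (by decide) = I.inv (ed w 0 1 (by decide)) :=
    (congrFun hW 1).trans (I.inv_ed w 0 1 (by decide)).symm
  have e2 : ed W 2 3 (by decide) = ed w 0 1 (by decide) := congrFun hW 2
  have e3 : ed W 3 4 (by decide) = ed w 1 2 (by decide) := congrFun hW 3
  have t1 := triple_ed W 1 2 3 (by decide) (by decide)
  have t2 := triple_ed W 2 3 4 (by decide) (by decide)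
  have t3 := left_assoc W (i := 1) (j := 2) (k := 3) (l := 4) (by decide) (by decide) (by decide)
  rw [e1, e2] at t1
  rw [e2, e3] at t2
  rw [t1.prod_unique (I.triple_inv_left _),
    t2.prod_unique (triple_ed w 0 1 2 (by decide) (by decide)), e1, e3] at t3
  exact t3 rfl

theorem triple_right {x y z : M _⦋1⦌} (h : Triple x y z) : Triple z (I.inv y) x := by
  obtain ⟨w, rfl, rfl, rfl⟩ := h
  -- Starting from the inverse of `w = [x|y]` gives `W = [x|y|y⁻¹|x⁻¹]`; the first three edges give
  -- `(xy)y⁻¹ = x`.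
  obtain ⟨W, hW, -⟩ := I.inv_mul 2 (by decide) (I.inv w)
  have e1 : ed W 0 1 (by decide) = ed w 0 1 (by decide) :=
    (congrFun hW 0).trans (congrArg (edge 0) (I.inv_inv w))
  have e2 : ed W 1 2 (by decide) = ed w 1 2 (by decide) :=
    (congrFun hW 1).trans (congrArg (edge 1) (I.inv_inv w))
  have e3 : ed W 2 3 (by decide) = I.inv (ed w 1 2 (by decide)) :=
    (congrFun hW 2).trans (I.inv_ed w 1 2 (by decide)).symm
  have t1 := triple_ed W 0 1 2 (by decide) (by decide)
  have t2 := triple_ed W 1 2 3 (by decide) (by decide)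
  have t3 := right_assoc W (i := 0) (j := 1) (k := 2) (l := 3) (by decide) (by decide) (by decide)
  rw [e1, e2] at t1
  rw [e2, e3] at t2
  rw [t2.prod_unique (I.triple_inv_right _),
    t1.prod_unique (triple_ed w 0 1 2 (by decide) (by decide)), e1, e3] at t3
  exact t3 rfl

end Inversion

instance {M : SSet.{u}} [IsPartialGroup M] : IsCancellative M where
  left_cancel h h' :=
    have ⟨I⟩ := IsPartialGroup.inversion (M := M)
    (I.triple_left h).prod_unique (I.triple_left h')
  right_cancel h h' :=
    have ⟨I⟩ := IsPartialGroup.inversion (M := M)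
    (I.triple_right h).prod_unique (I.triple_right h')

/-! ### Maps out of products with simplices -/

/-- The edge of `Δ[n]` joining `i` and `j`. -/
def simplexEdge {n : ℕ} (i j : Fin (n + 1)) (h : i ≤ j) : (Δ[n] : SSet.{u}) _⦋1⦌ :=
  SSet.stdSimplex.objEquiv.symm (SimplexCategory.mkOfLe i j h)

/-- The nondegenerate `n`-simplex of `Δ[n]`. -/
def topSimplex (n : ℕ) : (Δ[n] : SSet.{u}) _⦋n⦌ := SSet.stdSimplex.objEquiv.symm (𝟙 ⦋n⦌)

/-- The inclusion of `M` in `M × Δ[n]` over the vertex `k`. -/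
def inclAt (M : SSet.{u}) {n : ℕ} (k : Fin (n + 1)) : M ⟶ M ⊗ (Δ[n] : SSet.{u}) :=
  lift (𝟙 M) (SSet.const (SSet.stdSimplex.obj₀Equiv.symm k))

theorem map_topSimplex {n : ℕ} {m : SimplexCategoryᵒᵖ} (δ : (Δ[n] : SSet.{u}).obj m) :
    (Δ[n] : SSet.{u}).map (SSet.stdSimplex.objEquiv δ).op (topSimplex n) = δ :=
  (SSet.stdSimplex.map_objEquiv_symm (𝟙 ⦋n⦌) (SSet.stdSimplex.objEquiv δ).op).trans
    ((congrArg SSet.stdSimplex.objEquiv.symm (Category.comp_id (SSet.stdSimplex.objEquiv δ))).trans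
      (Equiv.symm_apply_apply _ _))

theorem ed_topSimplex {n : ℕ} (i j : Fin (n + 1)) (h : i ≤ j) :
    ed (topSimplex.{u} n) i j h = simplexEdge i j h := by
  rfl

theorem exists_eq_simplexEdge {n : ℕ} (δ : (Δ[n] : SSet.{u}) _⦋1⦌) :
    ∃ i j h, δ = simplexEdge i j h := by
  refine ⟨δ 0, δ 1, SSet.stdSimplex.monotone_apply δ (by decide), ?_⟩
  apply SSet.stdSimplex.ext
  intro i
  fin_cases i <;> rfl

/-- The value of `G` at the pair `(x, δ)`. -/
def ap {M X N : SSet.{u}} (G : M ⊗ X ⟶ N) {n : SimplexCategoryᵒᵖ} (x : M.obj n) (δ : X.obj n) :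
    N.obj n :=
  G.app n (x, δ)

theorem map_ap {M X N : SSet.{u}} (G : M ⊗ X ⟶ N) {n m : SimplexCategoryᵒᵖ} (θ : n ⟶ m)
    (x : M.obj n) (δ : X.obj n) : N.map θ (ap G x δ) = ap G (M.map θ x) (X.map θ δ) :=
  (app_map G θ _).symm

theorem ed_ap {M X N : SSet.{u}} (G : M ⊗ X ⟶ N) {n : ℕ} (x : M _⦋n⦌) (δ : X _⦋n⦌)
    (i j : Fin (n + 1)) (h : i ≤ j) : ed (ap G x δ) i j h = ap G (ed x i j h) (ed δ i j h) :=
  map_ap ..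

theorem ap_comp {M X N N' : SSet.{u}} (G : M ⊗ X ⟶ N) (f : N ⟶ N') {n : SimplexCategoryᵒᵖ}
    (x : M.obj n) (δ : X.obj n) : ap (G ≫ f) x δ = f.app n (ap G x δ) :=
  rfl

theorem ap_lift_comp {M X Y N N' : SSet.{u}} (C : M ⊗ X ⟶ N) (D : M ⊗ X ⟶ Y) (G : N ⊗ Y ⟶ N')
    {n : SimplexCategoryᵒᵖ} (x : M.obj n) (δ : X.obj n) :
    ap (lift C D ≫ G) x δ = ap G (ap C x δ) (ap D x δ) :=
  rfl

theorem ap_fst {M X : SSet.{u}} {n : SimplexCategoryᵒᵖ} (x : M.obj n) (δ : X.obj n) :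
    ap (fst M X) x δ = x :=
  rfl

theorem ap_snd {M X : SSet.{u}} {n : SimplexCategoryᵒᵖ} (x : M.obj n) (δ : X.obj n) :
    ap (snd M X) x δ = δ :=
  rfl

theorem ap_tensor_comp {M M' X X' N : SSet.{u}} (f : M ⟶ M') (g : X ⟶ X') (G : M' ⊗ X' ⟶ N)
    {n : SimplexCategoryᵒᵖ} (x : M.obj n) (δ : X.obj n) :
    ap ((f ⊗ₘ g) ≫ G) x δ = ap G (f.app n x) (g.app n δ) :=
  rfl

/-- The edge `(m, δ)` is the diagonal of the square spanned by `m` and `δ`. This triangle runs along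
`m` at the initial vertex of `δ` and then along `δ`; `triple_ap_right` is the other triangle.
Together they are the conjugation relation. -/
theorem triple_ap_left {M X N : SSet.{u}} [IsPartialMonoid M] (G : M ⊗ X ⟶ N) (m : M _⦋1⦌)
    (δ : X _⦋1⦌) : Triple (ap G m (ed δ 0 0 le_rfl)) (ap G (unit M) δ) (ap G m δ) := by
  refine Triple.map G ⟨(M.map (SimplexCategory.mkOfLeComp 0 1 1 (by decide) (by decide)).op m,
    X.map (SimplexCategory.mkOfLeComp 0 0 1 (by decide) (by decide)).op δ), ?_, ?_, ?_⟩
  · exact Prod.ext ((ed_map ..).trans (ed_zero_one m)) (ed_map ..)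
  · exact Prod.ext ((ed_map ..).trans (ed_self m 1)) ((ed_map ..).trans (ed_zero_one δ))
  · exact Prod.ext ((ed_map ..).trans (ed_zero_one m)) ((ed_map ..).trans (ed_zero_one δ))

theorem triple_ap_right {M X N : SSet.{u}} [IsPartialMonoid M] (G : M ⊗ X ⟶ N) (m : M _⦋1⦌)
    (δ : X _⦋1⦌) : Triple (ap G (unit M) δ) (ap G m (ed δ 1 1 le_rfl)) (ap G m δ) := by
  refine Triple.map G ⟨(M.map (SimplexCategory.mkOfLeComp 0 0 1 (by decide) (by decide)).op m,
    X.map (SimplexCategory.mkOfLeComp 0 1 1 (by decide) (by decide)).op δ), ?_, ?_, ?_⟩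
  · exact Prod.ext ((ed_map ..).trans (ed_self m 0)) ((ed_map ..).trans (ed_zero_one δ))
  · exact Prod.ext ((ed_map ..).trans (ed_zero_one m)) (ed_map ..)
  · exact Prod.ext ((ed_map ..).trans (ed_zero_one m)) ((ed_map ..).trans (ed_zero_one δ))

theorem ed_simplexEdge_left {n : ℕ} (i j : Fin (n + 1)) (h : i ≤ j) :
    ed (simplexEdge.{u} i j h) 0 0 le_rfl = simplexEdge i i le_rfl :=
  ed_map (SimplexCategory.mkOfLe i j h) (topSimplex.{u} n) 0 0 le_rfl

theorem ed_simplexEdge_right {n : ℕ} (i j : Fin (n + 1)) (h : i ≤ j) :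
    ed (simplexEdge.{u} i j h) 1 1 le_rfl = simplexEdge j j le_rfl :=
  ed_map (SimplexCategory.mkOfLe i j h) (topSimplex.{u} n) 1 1 le_rfl

/-- The `m`-simplex of `Δ[n]` at the vertex `k`. -/
def simplexConst {n : ℕ} (m : SimplexCategoryᵒᵖ) (k : Fin (n + 1)) : (Δ[n] : SSet.{u}).obj m :=
  (Δ[n] : SSet.{u}).map (m.unop.const ⦋0⦌ 0).op (SSet.stdSimplex.obj₀Equiv.symm k)

theorem simplexConst_one {n : ℕ} (k : Fin (n + 1)) :
    simplexConst.{u} (op ⦋1⦌) k = simplexEdge k k le_rfl := by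
  apply SSet.stdSimplex.ext
  intro i
  fin_cases i <;> rfl

theorem inclAt_comp_app {M N : SSet.{u}} {n : ℕ} (k : Fin (n + 1))
    (G : M ⊗ (Δ[n] : SSet.{u}) ⟶ N) {m : SimplexCategoryᵒᵖ} (x : M.obj m) :
    (inclAt M k ≫ G).app m x = ap G x (simplexConst m k) :=
  rfl

theorem ap_one_topSimplex {M N : SSet.{u}} [IsPartialMonoid M] {n : ℕ}
    (G : M ⊗ (Δ[n] : SSet.{u}) ⟶ N) {m : SimplexCategoryᵒᵖ} (δ : (Δ[n] : SSet.{u}).obj m) :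
    ap G (oneSimplex M m) δ =
      N.map (SSet.stdSimplex.objEquiv δ).op (ap G (oneSimplex M _) (topSimplex n)) := by
  rw [map_ap, map_oneSimplex, map_topSimplex]

/-- Edges suffice, by injectivity of spines. The value at the top simplex fixes `G` on `{1} × Δ[n]`;
the two triangles of a square and cancellation carry the values at the vertex `k` to every other
vertex; any other edge is then a product of known ones. -/
theorem prod_hom_ext {M N : SSet.{u}} [IsPartialMonoid M] [IsPartialMonoid N] [IsCancellative N]
    {n : ℕ}
    {G G' : M ⊗ (Δ[n] : SSet.{u}) ⟶ N} (k : Fin (n + 1)) (hk : inclAt M k ≫ G = inclAt M k ≫ G')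
    (h : ap G (oneSimplex M _) (topSimplex n) = ap G' (oneSimplex M _) (topSimplex n)) :
    G = G' := by
  have h1 : ∀ δ : (Δ[n] : SSet.{u}) _⦋1⦌, ap G (unit M) δ = ap G' (unit M) δ := by
    intro δ
    rw [unit_eq_oneSimplex, ap_one_topSimplex G δ, ap_one_topSimplex G' δ, h]
  have hk' : ∀ m : M _⦋1⦌, ap G m (simplexEdge k k le_rfl) = ap G' m (simplexEdge k k le_rfl) := by
    intro m
    rw [← simplexConst_one, ← inclAt_comp_app, hk, inclAt_comp_app]
  -- Use the edge of `Δ[n]` between `i` and `k`. The unknown is the left factor if `i ≤ k` and the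
  -- right factor if `k ≤ i`, which is why both cancellation laws are needed.
  have hv : ∀ (i : Fin (n + 1)) (m : M _⦋1⦌),
      ap G m (simplexEdge i i le_rfl) = ap G' m (simplexEdge i i le_rfl) := by
    intro i m
    rcases le_total i k with hik | hik
    · have a := triple_ap_left G m (simplexEdge i k hik)
      have b := triple_ap_right G m (simplexEdge i k hik)
      have a' := triple_ap_left G' m (simplexEdge i k hik)
      have b' := triple_ap_right G' m (simplexEdge i k hik)
      rw [ed_simplexEdge_left] at a a'
      rw [ed_simplexEdge_right] at b b'
      rw [h1, hk'] at b
      rw [b.prod_unique b', h1] at a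
      exact IsCancellative.right_cancel a a'
    · have a := triple_ap_left G m (simplexEdge k i hik)
      have b := triple_ap_right G m (simplexEdge k i hik)
      have a' := triple_ap_left G' m (simplexEdge k i hik)
      have b' := triple_ap_right G' m (simplexEdge k i hik)
      rw [ed_simplexEdge_left] at a a'
      rw [ed_simplexEdge_right] at b b'
      rw [h1, hk'] at a
      rw [a.prod_unique a', h1] at b
      exact IsCancellative.left_cancel b b'
  apply hom_ext_edges
  rintro ⟨m, δ⟩
  change ap G m δ = ap G' m δ
  obtain ⟨i, j, hij, rfl⟩ := exists_eq_simplexEdge δ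
  have a := triple_ap_left G m (simplexEdge i j hij)
  have a' := triple_ap_left G' m (simplexEdge i j hij)
  rw [ed_simplexEdge_left] at a a'
  rw [hv, h1] at a
  exact a.prod_unique a'

theorem hom_ext_app {X Y : SSet.{u}} {f g : X ⟶ Y}
    (h : ∀ (m : SimplexCategoryᵒᵖ) (x : X.obj m), f.app m x = g.app m x) : f = g := by
  ext m x
  exact h m x

theorem simplexEdge_zero_one : simplexEdge.{u} (n := 1) 0 1 (by decide) = topSimplex 1 := by
  apply SSet.stdSimplex.ext
  intro i
  fin_cases i <;> rfl

/-! ### Homotopies of a partial group ending at the identity -/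

theorem ap_simplexConst_one {M N : SSet.{u}} {n : ℕ} (k : Fin (n + 1))
    (G : M ⊗ (Δ[n] : SSet.{u}) ⟶ N) (x : M _⦋1⦌) :
    ap G x (simplexEdge k k le_rfl) = (inclAt M k ≫ G).app _ x := by
  rw [inclAt_comp_app, simplexConst_one]

/-- The reversal of a simplex of `Δ[n]`. -/
def simplexRev {n : ℕ} {m : SimplexCategoryᵒᵖ} (δ : (Δ[n] : SSet.{u}).obj m) :
    (Δ[n] : SSet.{u}).obj m :=
  SSet.stdSimplex.objEquiv.symm (SimplexCategory.rev.map (SSet.stdSimplex.objEquiv δ))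

theorem simplexRev_map {n : ℕ} {m m' : SimplexCategoryᵒᵖ} (θ : m ⟶ m')
    (δ : (Δ[n] : SSet.{u}).obj m) :
    simplexRev ((Δ[n] : SSet.{u}).map θ δ) =
      (Δ[n] : SSet.{u}).map (SimplexCategory.rev.map θ.unop).op (simplexRev δ) := by
  obtain ⟨f, rfl⟩ := SSet.stdSimplex.objEquiv.symm.surjective δ
  exact congrArg SSet.stdSimplex.objEquiv.symm (SimplexCategory.rev.map_comp θ.unop f)

theorem simplexRev_topSimplex (n : ℕ) : simplexRev (topSimplex.{u} n) = topSimplex n := by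
  apply SSet.stdSimplex.ext
  intro i
  exact Fin.rev_rev i

/-- The homotopy `(x, δ) ↦ K(x⁻¹, δ^rev)⁻¹`. -/
def Inversion.reverse {M : SSet.{u}} [IsPartialMonoid M] (I : Inversion M) {n : ℕ}
    (K : M ⊗ (Δ[n] : SSet.{u}) ⟶ M) : M ⊗ (Δ[n] : SSet.{u}) ⟶ M where
  app m := ↾fun p => I.inv (ap K (I.inv p.1) (simplexRev p.2))
  naturality m m' θ := by
    ext ⟨x, δ⟩
    change I.inv (ap K (I.inv (M.map θ x)) (simplexRev ((Δ[n] : SSet.{u}).map θ δ))) =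
      M.map θ (I.inv (ap K (I.inv x) (simplexRev δ)))
    rw [simplexRev_map, I.inv_map, ← map_ap, I.inv_map]
    exact congrArg (fun t : m'.unop ⟶ m.unop => M.map t.op (I.inv (ap K (I.inv x) (simplexRev δ))))
      (SimplexCategory.rev_map_rev_map θ.unop)

theorem Inversion.ap_reverse {M : SSet.{u}} [IsPartialMonoid M] (I : Inversion M) {n : ℕ}
    (K : M ⊗ (Δ[n] : SSet.{u}) ⟶ M) {m : SimplexCategoryᵒᵖ} (x : M.obj m)
    (δ : (Δ[n] : SSet.{u}).obj m) :
    ap (I.reverse K) x δ = I.inv (ap K (I.inv x) (simplexRev δ)) :=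
  rfl

theorem isIso_of_bijective {X Y : SSet.{u}} (f : X ⟶ Y)
    (h : ∀ n : SimplexCategoryᵒᵖ, Function.Bijective (f.app n)) : IsIso f := by
  have : ∀ n, IsIso (f.app n) := fun n => (isIso_iff_bijective _).2 (h n)
  exact NatIso.isIso_of_isIso_app f

theorem bijective_of_isIso {X Y : SSet.{u}} (f : X ⟶ Y) [IsIso f] (n : SimplexCategoryᵒᵖ) :
    Function.Bijective (f.app n) :=
  (isIso_iff_bijective _).1 inferInstance

/-- A homotopy ending at the identity with value `η` has as fibrewise inverse a homotopy `L` ending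
at the identity with value `η⁻¹`. Reversing `K` by the inversion produces such an `L` after
normalization at the final vertex, which requires the initial restriction of `K` to be invertible.
-/
theorem ap_bijective_of_homotopy {M : SSet.{u}} [IsPartialGroup M]
    {K : M ⊗ (Δ[1] : SSet.{u}) ⟶ M} (h1 : inclAt M 1 ≫ K = 𝟙 M) (h0 : IsIso (inclAt M 0 ≫ K))
    {n : SimplexCategoryᵒᵖ} (δ : (Δ[1] : SSet.{u}).obj n) :
    Function.Bijective (fun x : M.obj n => ap K x δ) := by
  obtain ⟨I⟩ := IsPartialGroup.inversion (M := M)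
  have hg : IsIso (inclAt M 1 ≫ I.reverse K) := by
    apply isIso_of_bijective
    intro m
    have hinv : Function.Bijective (I.inv : M.obj m → M.obj m) :=
      Function.Involutive.bijective I.inv_inv
    have := hinv.comp ((bijective_of_isIso (inclAt M 0 ≫ K) m).comp hinv)
    exact this
  obtain ⟨L, hL1, hLs⟩ : ∃ L : M ⊗ (Δ[1] : SSet.{u}) ⟶ M, inclAt M 1 ≫ L = 𝟙 M ∧
      ap L (unit M) (topSimplex 1) = I.inv (ap K (unit M) (topSimplex 1)) := by
    refine ⟨(CategoryTheory.inv (inclAt M 1 ≫ I.reverse K) ⊗ₘ 𝟙 _) ≫ I.reverse K, ?_, ?_⟩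
    · exact IsIso.inv_hom_id (inclAt M 1 ≫ I.reverse K)
    · rw [ap_tensor_comp, unit_eq_oneSimplex, app_oneSimplex, NatTrans.id_app]
      change ap (I.reverse K) (oneSimplex M _) (topSimplex 1) = _
      rw [Inversion.ap_reverse, I.inv_oneSimplex, simplexRev_topSimplex]
  -- The fibrewise composite of two homotopies ending at the identity again ends there, and its
  -- value is the product of their values. If that product is `1`, rigidity identifies the composite
  -- with the constant homotopy `fst`.
  have key : ∀ (P Q : M ⊗ (Δ[1] : SSet.{u}) ⟶ M), inclAt M 1 ≫ P = 𝟙 M → inclAt M 1 ≫ Q = 𝟙 M →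
      Triple (ap Q (unit M) (topSimplex 1)) (ap P (unit M) (topSimplex 1)) (unit M) →
      lift P (snd M _) ≫ Q = fst M _ := by
    intro P Q hP hQ ht
    apply prod_hom_ext 1
    · ext m x
      change ap Q ((inclAt M 1 ≫ P).app m x) (simplexConst m 1) = x
      rw [hP, ← inclAt_comp_app, hQ]
      rfl
    · rw [ap_lift_comp, ap_snd, ap_fst, ← unit_eq_oneSimplex]
      have h := triple_ap_right Q (ap P (unit M) (topSimplex 1)) (topSimplex 1)
      rw [ed_topSimplex, ap_simplexConst_one, hQ] at h
      exact h.prod_unique ht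
  have k1 := key K L h1 hL1 (by rw [hLs]; exact I.triple_inv_left _)
  have k2 := key L K hL1 h1 (by rw [hLs]; exact I.triple_inv_right _)
  refine Function.bijective_iff_has_inverse.2 ⟨fun x => ap L x δ, fun x => ?_, fun x => ?_⟩
  · exact congrArg (fun G => ap G x δ) k1
  · exact congrArg (fun G => ap G x δ) k2

/-! ### Composites of homotopies -/

/-- The map `[n] → [1]` with value `0` on `0, …, j` only. -/
def cut {n : ℕ} (j : Fin n) : ⦋n⦌ ⟶ ⦋1⦌ :=
  SimplexCategory.mkHom
    { toFun := fun i => if i ≤ j.castSucc then 0 else 1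
      monotone' := by
        intro a b hab
        dsimp only
        split_ifs with h h' h'
        · exact le_rfl
        · exact Fin.zero_le _
        · exact absurd (hab.trans h') h
        · exact le_rfl }

/-- The pullback of a homotopy along `cut j`. -/
def pullCut {M N : SSet.{u}} {n : ℕ} (K : M ⊗ (Δ[1] : SSet.{u}) ⟶ N) (j : Fin n) :
    M ⊗ (Δ[n] : SSet.{u}) ⟶ N :=
  (𝟙 M ⊗ₘ SSet.stdSimplex.map (cut j)) ≫ K

theorem ap_pullCut {M N : SSet.{u}} {n : ℕ} (K : M ⊗ (Δ[1] : SSet.{u}) ⟶ N) (j : Fin n)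
    {m : SimplexCategoryᵒᵖ} (x : M.obj m) (δ : (Δ[n] : SSet.{u}).obj m) :
    ap (pullCut K j) x δ = ap K x ((SSet.stdSimplex.map (cut j)).app m δ) :=
  rfl

theorem map_cut_simplexEdge {n : ℕ} (j : Fin n) (a b : Fin (n + 1)) (h : a ≤ b) (c d : Fin 2)
    (h' : c ≤ d) (hc : (cut j).toOrderHom a = c) (hd : (cut j).toOrderHom b = d) :
    (SSet.stdSimplex.map (cut j)).app _ (simplexEdge.{u} a b h) = simplexEdge c d h' := by
  subst hc hd
  exact congrArg SSet.stdSimplex.objEquiv.symm (mkOfLe_comp (cut j) a b h)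

/-- Stretch `K j` over `Δ[n]` so that it moves only along the `j`-th spine edge, and compose
fibrewise: `C(x, δ) = K₀(K₁(⋯))`, with `K j` evaluated at the image of `δ` under `cut j`. A
fibrewise composite of bijections is bijective. -/
theorem exists_composite_homotopy {M : SSet.{u}} [IsPartialGroup M] {n : ℕ} (s : M _⦋n⦌)
    (K : Fin n → (M ⊗ (Δ[1] : SSet.{u}) ⟶ M)) (h1 : ∀ j, inclAt M 1 ≫ K j = 𝟙 M)
    (hs : ∀ j, ap (K j) (unit M) (topSimplex 1) = edge j s) :
    ∃ C : M ⊗ (Δ[n] : SSet.{u}) ⟶ M, inclAt M (Fin.last n) ≫ C = 𝟙 M ∧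
      ap C (oneSimplex M _) (topSimplex n) = s ∧
      ((∀ j, IsIso (inclAt M 0 ≫ K j)) → ∀ (m : SimplexCategoryᵒᵖ) (δ : (Δ[n] : SSet.{u}).obj m),
        Function.Bijective (fun x : M.obj m => ap C x δ)) := by
  -- `d` counts the homotopies already composed, starting from the last edge: `C` realises the last
  -- `d` edges of `s` and takes the value `1` on the earlier ones.
  suffices H : ∀ d ≤ n, ∃ C : M ⊗ (Δ[n] : SSet.{u}) ⟶ M, inclAt M (Fin.last n) ≫ C = 𝟙 M ∧
      (∀ i : Fin n, ap C (unit M) (simplexEdge i.castSucc i.succ (Fin.castSucc_le_succ i)) =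
        if n ≤ i + d then edge i s else unit M) ∧
      ((∀ j, IsIso (inclAt M 0 ≫ K j)) → ∀ (m : SimplexCategoryᵒᵖ) (δ : (Δ[n] : SSet.{u}).obj m),
        Function.Bijective (fun x : M.obj m => ap C x δ)) by
    obtain ⟨C, hC, hCs, hb⟩ := H n le_rfl
    refine ⟨C, hC, ?_, hb⟩
    apply simplex_ext
    intro i
    have := hCs i
    rw [if_pos (by omega)] at this
    rw [← this, edge_eq_ed, ed_ap, ed_topSimplex, unit_eq_oneSimplex]
    congr 1
    exact map_oneSimplex _
  intro d
  induction d with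
  | zero =>
    refine fun _ => ⟨fst M _, rfl, fun i => ?_, fun _ m δ => Function.bijective_id⟩
    rw [if_neg (by omega)]
    rfl
  | succ d ih =>
    intro hd
    obtain ⟨C, hC, hCs, hb⟩ := ih (by omega)
    let j : Fin n := ⟨n - (d + 1), by omega⟩
    have hj : (j : ℕ) = n - (d + 1) := rfl
    refine ⟨lift C (snd M _) ≫ pullCut (K j) j, ?_, fun i => ?_, fun hiso m δ => ?_⟩
    · refine hom_ext_app fun m x => ?_
      have e : (SSet.stdSimplex.map (cut j)).app m (simplexConst.{u} m (Fin.last n)) =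
          simplexConst m 1 := by
        apply SSet.stdSimplex.objEquiv.injective
        ext i
        have : (cut j).toOrderHom (Fin.last n) = 1 := if_neg (by
          simp only [Fin.le_def, Fin.val_castSucc, Fin.val_last]
          omega)
        exact congrArg Fin.val this
      rw [inclAt_comp_app, ap_lift_comp, ap_snd, ap_pullCut, e, ← inclAt_comp_app, h1,
        ← inclAt_comp_app, hC]
      rfl
    · rw [ap_lift_comp, ap_snd, ap_pullCut, hCs]
      -- Before `j`, the restriction of `K j` to the vertex `0` acts on `1`; at `j`, `K j` acts on
      -- `1` and contributes `edge j s`; after `j`, `K j` is the identity and keeps the edge already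
      -- there.
      rcases lt_trichotomy i j with hij | rfl | hij
      · rw [if_neg (by omega), if_neg (by omega),
          map_cut_simplexEdge j _ _ _ 0 0 le_rfl (if_pos ?_) (if_pos ?_), ap_simplexConst_one,
          unit_eq_oneSimplex, app_oneSimplex]
        all_goals
          simp only [Fin.le_def, Fin.val_castSucc, Fin.val_succ]
          omega
      · rw [if_neg (by omega), if_pos (by omega),
          map_cut_simplexEdge j _ _ _ 0 1 (by decide) (if_pos le_rfl) (if_neg ?_),
          simplexEdge_zero_one, hs j]
        · simp only [Fin.le_def, Fin.val_castSucc, Fin.val_succ]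
          omega
      · rw [if_pos (by omega), if_pos (by omega),
          map_cut_simplexEdge j _ _ _ 1 1 le_rfl (if_neg ?_) (if_neg ?_), ap_simplexConst_one, h1]
        · rfl
        all_goals
          simp only [Fin.le_def, Fin.val_castSucc, Fin.val_succ]
          omega
    · exact (ap_bijective_of_homotopy (h1 j) (hiso j)
        ((SSet.stdSimplex.map (cut j)).app m δ)).comp (hb hiso m δ)

/-! ### Trivializations of a bundle -/

section Trivialization

variable {M E H : SSet.{u}} {τ : E ⟶ H} {n : ℕ} {b : H _⦋n⦌} {t : M ⊗ (Δ[n] : SSet.{u}) ⟶ E}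

theorem triv_proj (ht : IsPullback t (snd M Δ[n]) τ (SSet.yonedaEquiv.symm b))
    {m : SimplexCategoryᵒᵖ} (x : M.obj m) (δ : (Δ[n] : SSet.{u}).obj m) :
    τ.app m (ap t x δ) = H.map (SSet.stdSimplex.objEquiv δ).op b :=
  congrArg (fun G => ap G x δ) ht.w

theorem triv_injective (ht : IsPullback t (snd M Δ[n]) τ (SSet.yonedaEquiv.symm b))
    {m : SimplexCategoryᵒᵖ} {x x' : M.obj m} {δ : (Δ[n] : SSet.{u}).obj m}
    (h : ap t x δ = ap t x' δ) : x = x' :=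
  congrArg Prod.fst (Limits.Types.ext_of_isPullback (ht.map ((evaluation _ _).obj m))
    (x₁ := (x, δ)) (y₁ := (x', δ)) h rfl)

theorem triv_surjective (ht : IsPullback t (snd M Δ[n]) τ (SSet.yonedaEquiv.symm b))
    {m : SimplexCategoryᵒᵖ} (e : E.obj m) (δ : (Δ[n] : SSet.{u}).obj m)
    (h : τ.app m e = H.map (SSet.stdSimplex.objEquiv δ).op b) : ∃ x, ap t x δ = e := by
  obtain ⟨⟨x, δ'⟩, h1, h2⟩ := Limits.Types.exists_of_isPullback
    (ht.map ((evaluation _ _).obj m)) e δ h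
  obtain rfl : δ' = δ := h2
  exact ⟨x, h1⟩

theorem triv_lift (ht : IsPullback t (snd M Δ[n]) τ (SSet.yonedaEquiv.symm b)) {Y : SSet.{u}}
    (G : Y ⟶ E) (D : Y ⟶ Δ[n])
    (h : ∀ m (y : Y.obj m), τ.app m (G.app m y) =
      H.map (SSet.stdSimplex.objEquiv (D.app m y)).op b) :
    ∃ L : Y ⟶ M, lift L D ≫ t = G := by
  have w : G ≫ τ = D ≫ SSet.yonedaEquiv.symm b := hom_ext_app h
  refine ⟨ht.lift G D w ≫ fst _ _, ?_⟩
  have : lift (ht.lift G D w ≫ fst _ _) D = ht.lift G D w := by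
    apply CartesianMonoidalCategory.hom_ext
    · simp
    · simp
  rw [this, ht.lift_fst]

end Trivialization

theorem map_simplexConst {H : SSet.{u}} [IsPartialMonoid H] {n : ℕ} (b : H _⦋n⦌)
    (m : SimplexCategoryᵒᵖ) (k : Fin (n + 1)) :
    H.map (SSet.stdSimplex.objEquiv (simplexConst.{u} m k)).op b = oneSimplex H m := by
  refine Eq.trans ?_ (map_const_eq_oneSimplex
    (H.map (SimplexCategory.const ⦋0⦌ ⦋n⦌ k).op b))
  rw [← CategoryTheory.comp_apply, ← Functor.map_comp]
  rfl

theorem map_id_simplex {H : SSet.{u}} {n : ℕ} (b : H _⦋n⦌) :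
    H.map (SSet.stdSimplex.objEquiv (topSimplex.{u} n)).op b = b := by
  change H.map (𝟙 _) b = b
  rw [CategoryTheory.Functor.map_id]
  rfl

/-! ### Extensions -/

namespace IsExtension

variable {M E H : SSet.{u}} [IsPartialGroup M] [IsPartialGroup H] {ι : M ⟶ E} {τ : E ⟶ H}

theorem exists_trivialization (h : IsExtension ι τ) {n : ℕ} (b : H _⦋n⦌) :
    ∃ t, IsPullback t (snd M Δ[n]) τ (SSet.yonedaEquiv.symm b) :=
  h.bundle.locally_trivial n _

theorem hom_ext (h : IsExtension ι τ) {X : SSet.{u}} {f g : X ⟶ M} (hfg : f ≫ ι = g ≫ ι) :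
    f = g :=
  h.fibre.hom_ext hfg SSet.stdSimplex.ext₀

theorem proj_incl (h : IsExtension ι τ) {m : SimplexCategoryᵒᵖ} (x : M.obj m) :
    τ.app m (ι.app m x) = oneSimplex H m := by
  refine (congrArg (fun f => f.app m x) h.fibre.w).trans ?_
  rw [SSet.yonedaEquiv_symm_zero]
  rfl

theorem exists_lift (h : IsExtension ι τ) {X : SSet.{u}} (G : X ⟶ E)
    (hG : ∀ m (x : X.obj m), τ.app m (G.app m x) = oneSimplex H m) : ∃ L : X ⟶ M, L ≫ ι = G := by
  have w : G ≫ τ = SSet.stdSimplex.isTerminalObj₀.from X ≫ SSet.yonedaEquiv.symm (vertex H) := by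
    rw [SSet.yonedaEquiv_symm_zero]
    exact hom_ext_app hG
  exact ⟨h.fibre.lift _ _ w, h.fibre.lift_fst _ _ w⟩

theorem exists_incl_eq (h : IsExtension ι τ) {m : SimplexCategoryᵒᵖ} (e : E.obj m)
    (he : τ.app m e = oneSimplex H m) : ∃ x, ι.app m x = e := by
  have he' : τ.app m e = (SSet.yonedaEquiv.symm (vertex H) : (Δ[0] : SSet.{u}) ⟶ H).app m
      (simplexConst m 0) := by
    rw [he]
    exact (map_simplexConst _ _ _).symm
  obtain ⟨x, hx, -⟩ := Limits.Types.exists_of_isPullback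
    (h.fibre.map ((evaluation _ _).obj m)) e (simplexConst m 0) he'
  exact ⟨x, hx⟩

/-- Two simplices with equal spines have equal images in `H`, hence lie in one trivialization, where
injectivity of the spine of `M` applies. -/
theorem isPartialMonoid (h : IsExtension ι τ) : IsPartialMonoid E where
  reduced := by
    refine ⟨ι.app _ (vertex M), trivial, fun e _ => ?_⟩
    obtain ⟨x, rfl⟩ := h.exists_incl_eq e ((eq_vertex _).trans (eq_vertex _).symm)
    rw [eq_vertex x]
  spine_injective n _ x y hxy := by
    have hi : ∀ i : Fin n, ed x i.castSucc i.succ (Fin.castSucc_le_succ i) =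
      ed y i.castSucc i.succ (Fin.castSucc_le_succ i) := fun i => congrFun hxy i
    have hb : τ.app _ x = τ.app _ y := by
      apply simplex_ext
      intro i
      rw [edge_eq_ed, edge_eq_ed, ← app_ed, ← app_ed, hi]
    obtain ⟨t, ht⟩ := h.exists_trivialization (τ.app _ x)
    obtain ⟨p, hp⟩ := triv_surjective ht x (topSimplex n) (map_id_simplex _).symm
    obtain ⟨q, hq⟩ := triv_surjective ht y (topSimplex n) (hb.symm.trans (map_id_simplex _).symm)
    have hpq : p = q := by
      apply simplex_ext
      intro i
      apply triv_injective ht (δ := ed (topSimplex n) i.castSucc i.succ (Fin.castSucc_le_succ i))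
      rw [edge_eq_ed, edge_eq_ed, ← ed_ap, ← ed_ap, hp, hq, hi]
    rw [← hp, ← hq, hpq]

/-- Cancel first in `H`: two triangles sharing one factor and the product then lie over the same
`2`-simplex. A trivialization over it moves both to `M`, where cancellation holds. -/
theorem isCancellative (h : IsExtension ι τ) :
    have := h.isPartialMonoid
    IsCancellative E :=
  have := h.isPartialMonoid
  have key : ∀ w w' : E _⦋2⦌, τ.app _ w = τ.app _ w' → ∃ (t : M ⊗ (Δ[2] : SSet.{u}) ⟶ E)
      (p q : M _⦋2⦌), IsPullback t (snd M Δ[2]) τ (SSet.yonedaEquiv.symm (τ.app _ w)) ∧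
        ap t p (topSimplex 2) = w ∧ ap t q (topSimplex 2) = w' := by
    intro w w' hw
    obtain ⟨t, ht⟩ := h.exists_trivialization (τ.app _ w)
    obtain ⟨p, hp⟩ := triv_surjective ht w (topSimplex 2) (map_id_simplex _).symm
    obtain ⟨q, hq⟩ := triv_surjective ht w' (topSimplex 2) (hw.symm.trans (map_id_simplex _).symm)
    exact ⟨t, p, q, ht, hp, hq⟩
  { left_cancel := by
      rintro _ _ _ _ ⟨w, rfl, rfl, rfl⟩ h'
      have t2 := h'.map τ
      have t1 := Triple.map τ (triple_ed w 0 1 2 (by decide) (by decide))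
      obtain ⟨w', h1, rfl, h2⟩ := h'
      have hb := IsCancellative.left_cancel t1 t2
      obtain ⟨t, p, q, ht, rfl, rfl⟩ := key w w' (by
        apply simplex_ext_two
        · rw [← app_ed, ← app_ed, h1]
        · rw [← app_ed, ← app_ed, hb])
      simp only [ed_ap] at h1 h2 ⊢
      have e1 := triv_injective ht h1
      have e2 := triv_injective ht h2
      have s1 := triple_ed p 0 1 2 (by decide) (by decide)
      have s2 := triple_ed q 0 1 2 (by decide) (by decide)
      rw [e1, e2] at s2
      rw [IsCancellative.left_cancel s1 s2]
    right_cancel := by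
      rintro _ _ _ _ ⟨w, rfl, rfl, rfl⟩ h'
      have t2 := h'.map τ
      have t1 := Triple.map τ (triple_ed w 0 1 2 (by decide) (by decide))
      obtain ⟨w', rfl, h1, h2⟩ := h'
      have hb := IsCancellative.right_cancel t1 t2
      obtain ⟨t, p, q, ht, rfl, rfl⟩ := key w w' (by
        apply simplex_ext_two
        · rw [← app_ed, ← app_ed, hb]
        · rw [← app_ed, ← app_ed, h1])
      simp only [ed_ap] at h1 h2 ⊢
      have e1 := triv_injective ht h1
      have e2 := triv_injective ht h2
      have s1 := triple_ed p 0 1 2 (by decide) (by decide)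
      have s2 := triple_ed q 0 1 2 (by decide) (by decide)
      rw [e1, e2] at s2
      rw [IsCancellative.right_cancel s1 s2] }

/-- Rigidity with target `H`: a map that starts in the fibre at one vertex must lie over the image
of its value at the top simplex. -/
theorem proj_ap (h : IsExtension ι τ) {n : ℕ} {G : M ⊗ (Δ[n] : SSet.{u}) ⟶ E} (k : Fin (n + 1))
    {f : M ⟶ M} (hG : inclAt M k ≫ G = f ≫ ι) {b : H _⦋n⦌}
    (hb : τ.app _ (ap G (oneSimplex M _) (topSimplex n)) = b)
    {m : SimplexCategoryᵒᵖ} (x : M.obj m) (δ : (Δ[n] : SSet.{u}).obj m) :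
    τ.app m (ap G x δ) = H.map (SSet.stdSimplex.objEquiv δ).op b := by
  have : G ≫ τ = snd M _ ≫ SSet.yonedaEquiv.symm b := by
    apply prod_hom_ext k
    · refine hom_ext_app fun m x => ?_
      rw [← Category.assoc, hG]
      exact (h.proj_incl _).trans (map_simplexConst _ _ _).symm
    · exact hb.trans (map_id_simplex _).symm
  exact congrArg (fun G => ap G x δ) this

theorem exists_factor_inclAt (h : IsExtension ι τ) {n : ℕ} {G : M ⊗ (Δ[n] : SSet.{u}) ⟶ E}
    {b : H _⦋n⦌} (hG : ∀ (m : SimplexCategoryᵒᵖ) (x : M.obj m) (δ : (Δ[n] : SSet.{u}).obj m),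
      τ.app m (ap G x δ) = H.map (SSet.stdSimplex.objEquiv δ).op b) (k : Fin (n + 1)) :
    ∃ α : M ⟶ M, inclAt M k ≫ G = α ≫ ι := by
  obtain ⟨α, hα⟩ := h.exists_lift (inclAt M k ≫ G) (fun m x => by
    rw [inclAt_comp_app, hG, map_simplexConst])
  exact ⟨α, hα.symm⟩

/-- The trivialization at the vertex `k` and `ι` both identify `M` with the fibre over the vertex of
`H`, so they differ by an automorphism. Trivializations are not normalized, and these automorphisms
are the corrections used in `exists_transport`. -/
theorem exists_iso_inclAt (h : IsExtension ι τ) {n : ℕ} {b : H _⦋n⦌}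
    {t : M ⊗ (Δ[n] : SSet.{u}) ⟶ E} (ht : IsPullback t (snd M Δ[n]) τ (SSet.yonedaEquiv.symm b))
    (k : Fin (n + 1)) :
    ∃ a : M ⟶ M, IsIso a ∧ inclAt M k ≫ t = a ≫ ι := by
  obtain ⟨a, ha⟩ := h.exists_factor_inclAt (fun m x δ => triv_proj ht x δ) k
  obtain ⟨c, hc⟩ := triv_lift ht ι (SSet.const (SSet.stdSimplex.obj₀Equiv.symm k))
    (fun m x => (h.proj_incl x).trans (map_simplexConst b m k).symm)
  have hc' : c ≫ inclAt M k ≫ t = ι := hc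
  refine ⟨a, ⟨c, ?_, ?_⟩, ha⟩
  · refine hom_ext_app fun m x => triv_injective ht (δ := simplexConst m k) ?_
    have h1 : a ≫ c ≫ inclAt M k ≫ t = inclAt M k ≫ t := by rw [hc', ha]
    exact congrArg (fun f => f.app m x) h1
  · apply h.hom_ext
    rw [Category.assoc, ← ha, hc', Category.id_comp]

end IsExtension

/-! ### Transport along a regular section -/

namespace IsRegularSplitExtension

variable {M E H : SSet.{u}} [IsPartialGroup M] [IsPartialGroup H] {ι : M ⟶ E} {τ : E ⟶ H}
  {σ : H ⟶ E}

theorem proj_section (h : IsRegularSplitExtension ι τ σ) {n : SimplexCategoryᵒᵖ} (b : H.obj n) :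
    τ.app n (σ.app n b) = b :=
  congrArg (fun f => f.app n b) h.isSection

theorem exists_homotopy (h : IsRegularSplitExtension ι τ σ) (g : H _⦋1⦌) :
    ∃ F : M ⊗ (Δ[1] : SSet.{u}) ⟶ E, inclAt M 1 ≫ F = ι ∧
      ap F (oneSimplex M _) (topSimplex 1) = σ.app _ g := by
  obtain ⟨f, F, -, h1, hF⟩ := h.regular 1 g 0
  refine ⟨F, h1, ?_⟩
  rw [← unit_eq_oneSimplex]
  exact hF.trans (ed_zero_one _)

/-- The edge homotopies are moved into a trivialization over `b`, composed there and moved back.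
Bijectivity is only conditional here: invertibility of the initial restrictions comes from
functoriality, which can be stated only once these maps exist for all `b`.
`existsUnique_ap_transport` discharges the condition. -/
theorem exists_transport (h : IsRegularSplitExtension ι τ σ) {n : ℕ} (b : H _⦋n⦌) :
    ∃ Φ : M ⊗ (Δ[n] : SSet.{u}) ⟶ E, inclAt M (Fin.last n) ≫ Φ = ι ∧
      ap Φ (oneSimplex M _) (topSimplex n) = σ.app _ b ∧
      ((∀ (g : H _⦋1⦌) (F : M ⊗ (Δ[1] : SSet.{u}) ⟶ E) (α : M ⟶ M), inclAt M 1 ≫ F = ι →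
          ap F (oneSimplex M _) (topSimplex 1) = σ.app _ g → inclAt M 0 ≫ F = α ≫ ι → IsIso α) →
        ∀ (m : SimplexCategoryᵒᵖ) (e : E.obj m) (δ : (Δ[n] : SSet.{u}).obj m),
          τ.app m e = H.map (SSet.stdSimplex.objEquiv δ).op b → ∃! x, ap Φ x δ = e) := by
  obtain ⟨t, ht⟩ := h.extension.exists_trivialization b
  obtain ⟨s, hs⟩ := triv_surjective ht (σ.app _ b) (topSimplex n)
    ((h.proj_section b).trans (map_id_simplex b).symm)
  choose a ha hat using h.extension.exists_iso_inclAt ht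
  choose F hF1 hFσ using fun j : Fin n => h.exists_homotopy (edge j b)
  have hFτ : ∀ (j : Fin n) (m : SimplexCategoryᵒᵖ) (x : M.obj m) (δ : (Δ[1] : SSet.{u}).obj m),
      τ.app m (ap (F j) x δ) = H.map (SSet.stdSimplex.objEquiv δ).op (edge j b) :=
    fun j m x δ => h.extension.proj_ap 1 (f := 𝟙 M) (hF1 j)
      ((congrArg _ (hFσ j)).trans (h.proj_section _)) x δ
  have hL : ∀ j : Fin n, ∃ L : M ⊗ (Δ[1] : SSet.{u}) ⟶ M,
      lift L (snd M _ ≫ SSet.stdSimplex.map (SimplexCategory.mkOfSucc j)) ≫ t = F j := by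
    intro j
    apply triv_lift ht
    rintro m ⟨x, δ⟩
    refine (hFτ j m x δ).trans ?_
    unfold edge
    rw [← CategoryTheory.comp_apply, ← Functor.map_comp]
    rfl
  choose L hL using hL
  have hL' : ∀ (j : Fin n) (m : SimplexCategoryᵒᵖ) (x : M.obj m) (δ : (Δ[1] : SSet.{u}).obj m),
      ap t (ap (L j) x δ) ((SSet.stdSimplex.map (SimplexCategory.mkOfSucc j)).app m δ) =
        ap (F j) x δ := fun j m x δ => congrArg (fun G => ap G x δ) (hL j)
  -- At its final vertex `L j` is the inverse of `a j.succ`, because `F j` is `ι` there;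
  -- precomposing with `a j.succ` makes the homotopy end at the identity.
  let K : Fin n → (M ⊗ (Δ[1] : SSet.{u}) ⟶ M) := fun j => (a j.succ ⊗ₘ 𝟙 _) ≫ L j
  have hK1 : ∀ j, inclAt M 1 ≫ K j = 𝟙 M := by
    intro j
    refine hom_ext_app fun m x => ?_
    apply triv_injective ht (δ := simplexConst m j.succ)
    have e1 := hL' j m ((a j.succ).app m x) (simplexConst m 1)
    rw [← inclAt_comp_app 1 (F j), hF1 j] at e1
    exact e1.trans (congrArg (fun f => f.app m x) (hat j.succ)).symm
  have hK0 : ∀ j, (inclAt M 0 ≫ K j) ≫ a j.castSucc ≫ ι = a j.succ ≫ inclAt M 0 ≫ F j := by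
    intro j
    rw [← hat, ← hL j]
    rfl
  have hKs : ∀ j, ap (K j) (unit M) (topSimplex 1) = edge j s := by
    intro j
    have e1 := hL' j _ (oneSimplex M _) (topSimplex 1)
    rw [hFσ j, edge_eq_ed, app_ed, ← hs, ed_ap] at e1
    have e2 : ap (K j) (unit M) (topSimplex 1) = ap (L j) (oneSimplex M _) (topSimplex 1) := by
      rw [unit_eq_oneSimplex, ap_tensor_comp, app_oneSimplex]
      rfl
    rw [e2]
    exact triv_injective ht (δ := ed (topSimplex n) _ _ (Fin.castSucc_le_succ j)) e1
  obtain ⟨C, hC, hCs, hCb⟩ := exists_composite_homotopy s K hK1 hKs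
  have hΦ : ∀ (m : SimplexCategoryᵒᵖ) (x : M.obj m) (δ : (Δ[n] : SSet.{u}).obj m),
      ap ((CategoryTheory.inv (a (Fin.last n)) ⊗ₘ 𝟙 _) ≫ lift C (snd M _) ≫ t) x δ =
        ap t (ap C ((CategoryTheory.inv (a (Fin.last n))).app m x) δ) δ := fun _ _ _ => rfl
  -- `Φ(x, δ) = t(C(a⁻¹x, δ), δ)` with `a` the correction at the last vertex, so that `Φ` is exactly
  -- `ι` there.
  refine ⟨(CategoryTheory.inv (a (Fin.last n)) ⊗ₘ 𝟙 _) ≫ lift C (snd M _) ≫ t, ?_, ?_, ?_⟩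
  · refine hom_ext_app fun m x => ?_
    rw [inclAt_comp_app, hΦ, ← inclAt_comp_app _ C, hC]
    have := (IsIso.inv_comp_eq (a (Fin.last n))).2 (hat (Fin.last n))
    exact congrArg (fun f => f.app m x) this
  · rw [hΦ, app_oneSimplex, hCs, hs]
  · intro hiso m e δ he
    have hb := hCb (fun j => by
      obtain ⟨α, hα⟩ := h.extension.exists_factor_inclAt (hFτ j) 0
      have := hiso _ (F j) α (hF1 j) (hFσ j) hα
      have e1 : (inclAt M 0 ≫ K j) ≫ a j.castSucc = a j.succ ≫ α := by
        apply h.extension.hom_ext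
        rw [Category.assoc, hK0, hα, Category.assoc]
      rw [(IsIso.eq_comp_inv (a j.castSucc)).2 e1]
      infer_instance) m δ
    have hb' := hb.comp (bijective_of_isIso (CategoryTheory.inv (a (Fin.last n))) m)
    obtain ⟨y, hy⟩ := triv_surjective ht e δ he
    obtain ⟨x, rfl⟩ := hb'.2 y
    refine ⟨x, hy, fun x' hx' => ?_⟩
    exact hb'.1 (triv_injective ht (hx'.trans hy.symm))

/-- The trivialization over `b` which is `ι` at the last vertex and has `σ(b)` as value at the
nondegenerate simplex of `{1} × Δ[n]`. -/
def transport (h : IsRegularSplitExtension ι τ σ) {n : ℕ} (b : H _⦋n⦌) :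
    M ⊗ (Δ[n] : SSet.{u}) ⟶ E :=
  (h.exists_transport b).choose

theorem inclAt_last_transport (h : IsRegularSplitExtension ι τ σ) {n : ℕ} (b : H _⦋n⦌) :
    inclAt M (Fin.last n) ≫ h.transport b = ι :=
  (h.exists_transport b).choose_spec.1

theorem ap_transport_one (h : IsRegularSplitExtension ι τ σ) {n : ℕ} (b : H _⦋n⦌) :
    ap (h.transport b) (oneSimplex M _) (topSimplex n) = σ.app _ b :=
  (h.exists_transport b).choose_spec.2.1

theorem proj_transport (h : IsRegularSplitExtension ι τ σ) {n : ℕ} (b : H _⦋n⦌)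
    {m : SimplexCategoryᵒᵖ} (x : M.obj m) (δ : (Δ[n] : SSet.{u}).obj m) :
    τ.app m (ap (h.transport b) x δ) = H.map (SSet.stdSimplex.objEquiv δ).op b :=
  h.extension.proj_ap (Fin.last n) (f := 𝟙 M) (h.inclAt_last_transport b)
    ((congrArg _ (h.ap_transport_one b)).trans (h.proj_section b)) x δ

/-- The restriction of `transport b` to the vertex `k`, as a map to the fibre. -/
def fibreMap (h : IsRegularSplitExtension ι τ σ) {n : ℕ} (b : H _⦋n⦌) (k : Fin (n + 1)) : M ⟶ M :=
  (h.extension.exists_factor_inclAt (fun _ x δ => h.proj_transport b x δ) k).choose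

theorem inclAt_transport (h : IsRegularSplitExtension ι τ σ) {n : ℕ} (b : H _⦋n⦌)
    (k : Fin (n + 1)) : inclAt M k ≫ h.transport b = h.fibreMap b k ≫ ι :=
  (h.extension.exists_factor_inclAt (fun _ x δ => h.proj_transport b x δ) k).choose_spec

theorem fibreMap_last (h : IsRegularSplitExtension ι τ σ) {n : ℕ} (b : H _⦋n⦌) :
    h.fibreMap b (Fin.last n) = 𝟙 M := by
  apply h.extension.hom_ext
  rw [← inclAt_transport, inclAt_last_transport, Category.id_comp]

theorem hom_ext_of_section (h : IsRegularSplitExtension ι τ σ) {n : ℕ}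
    {G G' : M ⊗ (Δ[n] : SSet.{u}) ⟶ E} (k : Fin (n + 1)) (hk : inclAt M k ≫ G = inclAt M k ≫ G')
    (hG : ap G (oneSimplex M _) (topSimplex n) = ap G' (oneSimplex M _) (topSimplex n)) :
    G = G' :=
  have := h.extension.isPartialMonoid
  have := h.extension.isCancellative
  prod_hom_ext k hk hG

/-- Both sides agree at the last vertex of `Δ[m]` and have the same value at the top simplex, so
rigidity applies. The factor `fibreMap` appears because `θ` need not preserve last vertices, where
transports are normalized. -/
theorem transport_map (h : IsRegularSplitExtension ι τ σ) {n m : ℕ} (θ : ⦋m⦌ ⟶ ⦋n⦌)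
    (b : H _⦋n⦌) :
    (𝟙 M ⊗ₘ SSet.stdSimplex.map θ) ≫ h.transport b =
      (h.fibreMap b (θ.toOrderHom (Fin.last m)) ⊗ₘ 𝟙 _) ≫ h.transport (H.map θ.op b) := by
  apply h.hom_ext_of_section (Fin.last m)
  · have e1 : inclAt M (Fin.last m) ≫ (𝟙 M ⊗ₘ SSet.stdSimplex.map θ) ≫ h.transport b =
        inclAt M (θ.toOrderHom (Fin.last m)) ≫ h.transport b := rfl
    have e2 : inclAt M (Fin.last m) ≫ (h.fibreMap b (θ.toOrderHom (Fin.last m)) ⊗ₘ 𝟙 _) ≫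
        h.transport (H.map θ.op b) = h.fibreMap b (θ.toOrderHom (Fin.last m)) ≫
          inclAt M (Fin.last m) ≫ h.transport (H.map θ.op b) := rfl
    rw [e1, e2, inclAt_last_transport, inclAt_transport]
  · have e2 : ap ((h.fibreMap b (θ.toOrderHom (Fin.last m)) ⊗ₘ 𝟙 _) ≫ h.transport (H.map θ.op b))
        (oneSimplex M _) (topSimplex m) = ap (h.transport (H.map θ.op b))
          ((h.fibreMap b (θ.toOrderHom (Fin.last m))).app _ (oneSimplex M _)) (topSimplex m) := rfl
    rw [e2, app_oneSimplex, ap_transport_one, app_map, ← h.ap_transport_one b, map_ap,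
      map_oneSimplex]
    have e3 : (Δ[n] : SSet.{u}).map θ.op (topSimplex n) =
        (SSet.stdSimplex.map θ).app _ (topSimplex m) :=
      SSet.stdSimplex.ext _ _ fun _ => rfl
    rw [e3]
    rfl

theorem ap_transport_map (h : IsRegularSplitExtension ι τ σ) {n m : ℕ} (θ : ⦋m⦌ ⟶ ⦋n⦌)
    (b : H _⦋n⦌) {l : SimplexCategoryᵒᵖ} (x : M.obj l) (δ : (Δ[m] : SSet.{u}).obj l) :
    ap (h.transport b) x ((SSet.stdSimplex.map θ).app l δ) =
      ap (h.transport (H.map θ.op b)) ((h.fibreMap b (θ.toOrderHom (Fin.last m))).app l x) δ :=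
  congrArg (fun G => ap G x δ) (h.transport_map θ b)

theorem fibreMap_map (h : IsRegularSplitExtension ι τ σ) {n m : ℕ} (θ : ⦋m⦌ ⟶ ⦋n⦌)
    (b : H _⦋n⦌) (j : Fin (m + 1)) : h.fibreMap b (θ.toOrderHom j) =
      h.fibreMap b (θ.toOrderHom (Fin.last m)) ≫ h.fibreMap (H.map θ.op b) j := by
  apply h.extension.hom_ext
  rw [← inclAt_transport, Category.assoc, ← inclAt_transport]
  exact congrArg (fun G => inclAt M j ≫ G) (h.transport_map θ b)

theorem fibreMap_unit (h : IsRegularSplitExtension ι τ σ) : h.fibreMap (unit H) 0 = 𝟙 M := by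
  have e := h.fibreMap_map (SimplexCategory.const ⦋1⦌ ⦋0⦌ 0) (vertex H) 0
  have e1 : h.fibreMap (vertex H) 0 = 𝟙 M := h.fibreMap_last (vertex H)
  have e2 : H.map (SimplexCategory.const ⦋1⦌ ⦋0⦌ 0).op (vertex H) = unit H :=
    (unit_eq_oneSimplex H).symm
  rw [e2] at e
  exact (Category.id_comp _).symm.trans
    ((congrArg (fun f => f ≫ h.fibreMap (unit H) 0) e1).symm.trans (e.symm.trans e1))

/-- Transport runs from the last vertex back to the first, so `b` acts before `a`. With `f * g = g ≫
f` in `Aut M` this is multiplicativity in the usual order. -/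
theorem fibreMap_triple (h : IsRegularSplitExtension ι τ σ) {a b c : H _⦋1⦌} (t : Triple a b c) :
    h.fibreMap b 0 ≫ h.fibreMap a 0 = h.fibreMap c 0 := by
  obtain ⟨w, rfl, rfl, rfl⟩ := t
  have e1 := h.fibreMap_map (SimplexCategory.mkOfLe 0 1 (by decide)) w 0
  have e2 := h.fibreMap_map (SimplexCategory.mkOfLe 1 2 (by decide)) w 0
  have e3 := h.fibreMap_map (SimplexCategory.mkOfLe 0 2 (by decide)) w 0
  have e4 : h.fibreMap w 2 = 𝟙 M := h.fibreMap_last w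
  change h.fibreMap w 0 = h.fibreMap w 1 ≫ h.fibreMap (ed w 0 1 (by decide)) 0 at e1
  change h.fibreMap w 1 = h.fibreMap w 2 ≫ h.fibreMap (ed w 1 2 (by decide)) 0 at e2
  change h.fibreMap w 0 = h.fibreMap w 2 ≫ h.fibreMap (ed w 0 2 (by decide)) 0 at e3
  rw [e4, Category.id_comp] at e2 e3
  rw [← e2, ← e3, e1]

/-- Multiplicativity makes the map of `g⁻¹` a two-sided inverse of the map of `g`; this is where
inverses in `H` give automorphisms instead of endomorphisms. -/
theorem isIso_fibreMap_edge (h : IsRegularSplitExtension ι τ σ) (g : H _⦋1⦌) :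
    IsIso (h.fibreMap g 0) := by
  obtain ⟨I⟩ := IsPartialGroup.inversion (M := H)
  refine ⟨h.fibreMap (I.inv g) 0, ?_, ?_⟩
  · rw [h.fibreMap_triple (I.triple_inv_left g), fibreMap_unit]
  · rw [h.fibreMap_triple (I.triple_inv_right g), fibreMap_unit]

instance isIso_fibreMap (h : IsRegularSplitExtension ι τ σ) {n : ℕ} (b : H _⦋n⦌)
    (k : Fin (n + 1)) : IsIso (h.fibreMap b k) := by
  have e := h.fibreMap_map (SimplexCategory.mkOfLe k (Fin.last n) (Fin.le_last k)) b 0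
  change h.fibreMap b k = h.fibreMap b (Fin.last n) ≫ h.fibreMap (ed b _ _ _) 0 at e
  rw [e, fibreMap_last, Category.id_comp]
  exact h.isIso_fibreMap_edge _

theorem existsUnique_ap_transport (h : IsRegularSplitExtension ι τ σ) {n : ℕ} (b : H _⦋n⦌)
    (e : E _⦋n⦌) (he : τ.app _ e = b) : ∃! x, ap (h.transport b) x (topSimplex n) = e := by
  refine (h.exists_transport b).choose_spec.2.2 (fun g F α h1 hF h0 => ?_) _ e _
    (he.trans (map_id_simplex b).symm)
  -- By rigidity the homotopy over an edge is unique, so its initial restriction is `fibreMap g 0`,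
  -- already known to be invertible.
  have : F = h.transport g := h.hom_ext_of_section 1 (h1.trans (h.inclAt_last_transport g).symm)
    (hF.trans (h.ap_transport_one g).symm)
  have e1 : α = h.fibreMap g 0 := by
    apply h.extension.hom_ext
    rw [← h0, this, inclAt_transport]
  rw [e1]
  infer_instance

end IsRegularSplitExtension

/-! ### Simplices of the bar construction -/

/-- The simplex `[p₀⁻¹p₁|…|p_{n-1}⁻¹pₙ]` of `BG`. -/
def barOfVertices {G : Type u} [Group G] {n : SimplexCategoryᵒᵖ} (p : Fin (n.unop.len + 1) → G) :
    (bar G).obj n :=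
  show ComposableArrows (SingleObj Gᵐᵒᵖ) n.unop.len from
  { obj _ := SingleObj.star _
    map {i j} _ := MulOpposite.op ((p i)⁻¹ * p j)
    map_id i := congrArg MulOpposite.op (inv_mul_cancel (p i))
    map_comp {i j k} _ _ := congrArg MulOpposite.op
      (show (p i)⁻¹ * p k = ((p i)⁻¹ * p j) * ((p j)⁻¹ * p k) by group) }

theorem barProd_barOfVertices {G : Type u} [Group G] {n : SimplexCategoryᵒᵖ}
    (p : Fin (n.unop.len + 1) → G) {i j : Fin (n.unop.len + 1)} (h : i ≤ j) :
    barProd (barOfVertices p) h = (p i)⁻¹ * p j :=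
  rfl

theorem bar_ext {G : Type u} [Group G] {n : SimplexCategoryᵒᵖ} {s s' : (bar G).obj n}
    (h : ∀ k : Fin (n.unop.len + 1), barProd s (Fin.zero_le k) = barProd s' (Fin.zero_le k)) :
    s = s' := by
  have key : ∀ {i j : Fin (n.unop.len + 1)} (hij : i ≤ j), barProd s hij = barProd s' hij := by
    intro i j hij
    have e := barProd_mul s (Fin.zero_le i) hij
    rw [h, h, ← barProd_mul s' (Fin.zero_le i) hij] at e
    exact mul_left_cancel e
  refine CategoryTheory.Functor.ext (C := Fin (n.unop.len + 1)) (D := SingleObj Gᵐᵒᵖ)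
    (fun _ => rfl) (fun i j f => ?_)
  simp only [eqToHom_refl, Category.comp_id, Category.id_comp]
  exact MulOpposite.unop_injective (key (leOfHom f))

/-- Only the ratios of the vertex labels matter. This absorbs the change of normalization when
passing to a face, and so gives the naturality of `action`. -/
theorem barOfVertices_mul_left {G : Type u} [Group G] {n : SimplexCategoryᵒᵖ}
    (p : Fin (n.unop.len + 1) → G) (g : G) :
    barOfVertices (n := n) (fun k => g * p k) = barOfVertices p := by
  apply bar_ext
  intro k
  rw [barProd_barOfVertices, barProd_barOfVertices]
  group

/-! ### Transport along isomorphisms -/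

theorem IsSplitExtensionIso.isRegularSplitExtension {M E E' H : SSet.{u}} [IsPartialGroup M]
    [IsPartialGroup H] {ι : M ⟶ E} {τ : E ⟶ H} {σ : H ⟶ E} {ι' : M ⟶ E'} {τ' : E' ⟶ H}
    {σ' : H ⟶ E'} {φ : E' ≅ E} (hφ : IsSplitExtensionIso ι' τ' σ' ι τ σ φ)
    (h : IsRegularSplitExtension ι τ σ) : IsRegularSplitExtension ι' τ' σ' := by
  obtain ⟨h1, h2, h3⟩ := hφ
  -- This exhibits `ι'` and `σ'` as composites with `φ.inv`, so that the primed data can be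
  -- eliminated.
  rw [← Iso.eq_comp_inv] at h1 h3
  subst h1 h2 h3
  refine ⟨⟨⟨fun n => ?_, fun n b => ?_⟩, ?_⟩, ?_, fun n b i => ?_⟩
  · exact (h.extension.bundle.surjective n).comp (bijective_of_isIso φ.hom n).2
  · obtain ⟨t, ht⟩ := h.extension.bundle.locally_trivial n b
    exact ⟨t ≫ φ.inv, ht.of_iso (Iso.refl _) φ.symm (Iso.refl _) (Iso.refl _)
      (by simp) (by simp) (by simp) (by simp)⟩
  · exact h.extension.fibre.of_iso (Iso.refl _) φ.symm (Iso.refl _) (Iso.refl _)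
      (by simp) (by simp) (by simp) (by simp)
  · simpa using h.isSection
  · obtain ⟨f, F, h0, h1, hF⟩ := h.regular n b i
    refine ⟨f ≫ φ.inv, F ≫ φ.inv, by rw [← h0, Category.assoc], by rw [← h1, Category.assoc], ?_⟩
    exact (congrArg (φ.inv.app _) hF).trans (app_map φ.inv _ _)

/-! ### The semidirect product -/

/-- The map `M × Δ[n] → M ⋊ H` determined by `b`. -/
def semidirectTransport {M H : SSet.{u}} (ρ : H ⟶ bar (Aut M)) {n : ℕ} (b : H _⦋n⦌) :
    M ⊗ (Δ[n] : SSet.{u}) ⟶ semidirect ρ where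
  app m := ↾fun p => ((actProd ρ b ((SSet.stdSimplex.objEquiv p.2).toOrderHom 0)).inv.app m p.1,
    H.map (SSet.stdSimplex.objEquiv p.2).op b)
  naturality m m' θ := by
    ext ⟨x, δ⟩
    obtain ⟨f, rfl⟩ := SSet.stdSimplex.objEquiv.symm.surjective δ
    refine Prod.ext ?_ ?_
    · have e := actProd_map ρ f.op b (θ.unop.toOrderHom 0)
      change (actProd ρ b (f.toOrderHom (θ.unop.toOrderHom 0))).inv.app m' (M.map θ x) =
        (actProd ρ (H.map f.op b) (θ.unop.toOrderHom 0)).inv.app m'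
          (M.map θ ((actProd ρ b (f.toOrderHom 0)).inv.app m x))
      rw [← app_map]
      exact congrArg (fun g : Aut M => g.inv.app m' (M.map θ x)) e.symm
    · change H.map (f.op ≫ θ) b = H.map θ (H.map f.op b)
      rw [Functor.map_comp]
      rfl

theorem inclAt_semidirectTransport {M H : SSet.{u}} [IsPartialMonoid H] (ρ : H ⟶ bar (Aut M))
    {n : ℕ} (b : H _⦋n⦌) (k : Fin (n + 1)) :
    inclAt M k ≫ semidirectTransport ρ b =
      (actProd ρ (n := op ⦋n⦌) b k).inv ≫ semidirectIncl ρ :=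
  hom_ext_app fun m _ => Prod.ext rfl (map_simplexConst b m k)

theorem ap_semidirectTransport_top {M H : SSet.{u}} (ρ : H ⟶ bar (Aut M)) {n : ℕ} (x : M _⦋n⦌)
    (b : H _⦋n⦌) : ap (semidirectTransport ρ b) x (topSimplex n) = (x, b) :=
  Prod.ext (congrArg (fun g : Aut M => g.inv.app (op ⦋n⦌) x) (actProd_zero ρ (n := op ⦋n⦌) b))
    (map_id_simplex b)

theorem bijective_aut_inv {M : SSet.{u}} (g : Aut M) (n : SimplexCategoryᵒᵖ) :
    Function.Bijective (g.inv.app n) :=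
  have : IsIso g.inv := Iso.isIso_inv (show M ≅ M from g)
  bijective_of_isIso g.inv n

/-! ### The action, the comparison isomorphism, and uniqueness -/

namespace IsRegularSplitExtension

variable {M E H : SSet.{u}} [IsPartialGroup M] [IsPartialGroup H] {ι : M ⟶ E} {τ : E ⟶ H}
  {σ : H ⟶ E}

/-- `fibreMap` as an automorphism. -/
def fibreAut (h : IsRegularSplitExtension ι τ σ) {n : ℕ} (b : H _⦋n⦌) (k : Fin (n + 1)) : Aut M :=
  asIso (h.fibreMap b k)

theorem fibreAut_map (h : IsRegularSplitExtension ι τ σ) {n m : ℕ} (θ : ⦋m⦌ ⟶ ⦋n⦌)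
    (b : H _⦋n⦌) (j : Fin (m + 1)) : h.fibreAut b (θ.toOrderHom j) =
      h.fibreAut (H.map θ.op b) j * h.fibreAut b (θ.toOrderHom (Fin.last m)) :=
  Iso.ext (h.fibreMap_map θ b j)

/-- The action of `H` on `M` determined by a regular section. -/
def action (h : IsRegularSplitExtension ι τ σ) : H ⟶ bar (Aut M) where
  app n := ↾fun b => barOfVertices fun k => (h.fibreAut (n := n.unop.len) b k)⁻¹
  naturality n m θ := by
    ext b
    change barOfVertices (n := m) (fun k => (h.fibreAut (n := m.unop.len) (H.map θ b) k)⁻¹) =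
      barOfVertices (n := m) fun k => (h.fibreAut (n := n.unop.len) b (θ.unop.toOrderHom k))⁻¹
    have e : ∀ k, (h.fibreAut (n := n.unop.len) b (θ.unop.toOrderHom k))⁻¹ =
        (h.fibreAut (n := n.unop.len) b (θ.unop.toOrderHom (Fin.last _)))⁻¹ *
          (h.fibreAut (n := m.unop.len) (H.map θ b) k)⁻¹ := fun k =>
      (congrArg _ (h.fibreAut_map (n := n.unop.len) (m := m.unop.len) θ.unop b k)).trans
        (mul_inv_rev _ _)
    exact (barOfVertices_mul_left _ _).symm.trans (congrArg barOfVertices (funext e).symm)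

theorem actProd_action (h : IsRegularSplitExtension ι τ σ) {n : ℕ} (b : H _⦋n⦌)
    (k : Fin (n + 1)) : actProd h.action (n := op ⦋n⦌) b k = h.fibreAut b 0 * (h.fibreAut b k)⁻¹ :=
  congrArg (· * (h.fibreAut b k)⁻¹) (inv_inv _)

/-- The comparison map `M ⋊ H → E`. -/
def compare (h : IsRegularSplitExtension ι τ σ) : semidirect h.action ⟶ E where
  -- The inverse changes normalization: `transport` is `ι` at the last vertex, whereas the
  -- coordinates of the semidirect product are based at the first.
  app n := ↾fun p => ap (h.transport (n := n.unop.len) p.2)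
    ((h.fibreAut (n := n.unop.len) p.2 0).inv.app n p.1) (topSimplex n.unop.len)
  naturality n m θ := by
    ext ⟨x, b⟩
    obtain ⟨n⟩ := n
    obtain ⟨m⟩ := m
    obtain ⟨θ, rfl⟩ : ∃ θ' : m ⟶ n, θ = θ'.op := ⟨θ.unop, rfl⟩
    induction n using SimplexCategory.rec with | _ n =>
    induction m using SimplexCategory.rec with | _ m =>
    change ap (h.transport (H.map θ.op b)) ((h.fibreAut (H.map θ.op b) 0).inv.app _
        ((actProd h.action (n := op ⦋n⦌) b (θ.toOrderHom 0)).inv.app _ (M.map θ.op x)))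
          (topSimplex m) =
      E.map θ.op (ap (h.transport b) ((h.fibreAut b 0).inv.app _ x) (topSimplex n))
    have e3 : (Δ[n] : SSet.{u}).map θ.op (topSimplex n) =
        (SSet.stdSimplex.map θ).app _ (topSimplex m) :=
      SSet.stdSimplex.ext _ _ fun _ => rfl
    rw [map_ap, e3, ap_transport_map, actProd_action, fibreAut_map, ← app_map]
    congr 1
    -- The twist of the semidirect product at `θ 0` and the change of last vertex under `θ` cancel,
    -- leaving the same automorphism on both sides.
    have e4 : (h.fibreAut (H.map θ.op b) 0)⁻¹ * (h.fibreAut b 0 * (h.fibreAut (H.map θ.op b) 0 *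
        h.fibreAut b (θ.toOrderHom (Fin.last m)))⁻¹)⁻¹ =
        h.fibreAut b (θ.toOrderHom (Fin.last m)) * (h.fibreAut b 0)⁻¹ := by
      group
    exact congrArg (fun g : Aut M => g.hom.app _ (M.map θ.op x)) e4

theorem compare_app (h : IsRegularSplitExtension ι τ σ) {n : ℕ} (x : M _⦋n⦌) (b : H _⦋n⦌) :
    h.compare.app (op ⦋n⦌) (x, b) =
      ap (h.transport b) ((h.fibreAut b 0).inv.app _ x) (topSimplex n) :=
  rfl

/-- The base simplex is a degeneracy of the vertex of `H`, and over the vertex transport is `ι`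
itself; functoriality passes this to the degeneracy. -/
theorem transport_const (h : IsRegularSplitExtension ι τ σ) {n : ℕ} (x : M _⦋n⦌) :
    ap (h.transport (oneSimplex H (op ⦋n⦌))) ((h.fibreAut (oneSimplex H (op ⦋n⦌)) 0).inv.app _ x)
      (topSimplex n) = ι.app _ x := by
  have e1 : h.fibreMap (vertex H) 0 = 𝟙 M := h.fibreMap_last (vertex H)
  have e2 := h.fibreMap_map (SimplexCategory.const ⦋n⦌ ⦋0⦌ 0) (vertex H) 0
  change h.fibreMap (vertex H) 0 = h.fibreMap (vertex H) 0 ≫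
    h.fibreMap (oneSimplex H (op ⦋n⦌)) 0 at e2
  rw [e1, Category.id_comp] at e2
  have e3 : (h.fibreAut (oneSimplex H (op ⦋n⦌)) 0) = 1 := Iso.ext e2.symm
  have e4 := h.ap_transport_map (SimplexCategory.const ⦋n⦌ ⦋0⦌ 0) (vertex H) x (topSimplex n)
  have e5 : (h.fibreMap (vertex H)
      ((SimplexCategory.const ⦋n⦌ ⦋0⦌ 0).toOrderHom (Fin.last n))) = 𝟙 M := e1
  rw [e5] at e4
  rw [e3]
  refine e4.symm.trans ?_
  have e6 := congrArg (fun f => f.app _ x) (h.inclAt_last_transport (vertex H))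
  refine Eq.trans ?_ e6
  change ap _ _ _ = ap _ _ _
  congr 1

theorem compare_bijective (h : IsRegularSplitExtension ι τ σ) (n : SimplexCategoryᵒᵖ) :
    Function.Bijective (h.compare.app n) := by
  obtain ⟨n⟩ := n
  induction n using SimplexCategory.rec with | _ n =>
  have hτ : ∀ (x : M _⦋n⦌) (b : H _⦋n⦌), τ.app _ (h.compare.app (op ⦋n⦌) (x, b)) = b :=
    fun x b => by rw [compare_app, proj_transport, map_id_simplex]
  constructor
  · rintro ⟨x, b⟩ ⟨x', b'⟩ hx
    have hb : b = b' := (hτ x b).symm.trans ((congrArg _ hx).trans (hτ x' b'))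
    subst hb
    have e := (h.existsUnique_ap_transport b _ (hτ x b)).unique (h.compare_app x b).symm
      ((h.compare_app x' b).symm.trans hx.symm)
    exact Prod.ext ((bijective_aut_inv (h.fibreAut b 0) (op ⦋n⦌)).1 e) rfl
  · intro e
    obtain ⟨y, hy, -⟩ := h.existsUnique_ap_transport (τ.app _ e) e rfl
    obtain ⟨x, rfl⟩ := (bijective_aut_inv (h.fibreAut (τ.app _ e) 0) (op ⦋n⦌)).2 y
    exact ⟨(x, τ.app _ e), hy⟩

/-- The comparison isomorphism `M ⋊ H ≅ E`. -/
def compareIso (h : IsRegularSplitExtension ι τ σ) : semidirect h.action ≅ E :=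
  have := isIso_of_bijective h.compare h.compare_bijective
  asIso h.compare

theorem isSplitExtensionIso_compareIso (h : IsRegularSplitExtension ι τ σ) :
    IsSplitExtensionIso (semidirectIncl h.action) (semidirectProj h.action)
      (semidirectSection h.action) ι τ σ h.compareIso where
  incl := hom_ext_app fun m x => by
    obtain ⟨n⟩ := m
    induction n using SimplexCategory.rec with | _ n =>
    exact h.transport_const x
  proj := hom_ext_app fun m x => by
    obtain ⟨n⟩ := m
    induction n using SimplexCategory.rec with | _ n =>
    exact (h.proj_transport _ _ _).trans (map_id_simplex _)
  sect := hom_ext_app fun m b => by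
    obtain ⟨n⟩ := m
    induction n using SimplexCategory.rec with | _ n =>
    refine Eq.trans ?_ (h.ap_transport_one b)
    change ap (h.transport b) ((h.fibreAut b 0).inv.app _ (oneSimplex M _)) _ = _
    rw [app_oneSimplex]

/-- Both sides are `ι` at the vertex `0` and take the value `σ(b)`, so rigidity makes them equal.
Restricting to the other vertices recovers `ρ` (`actProd_eq`), and evaluating at the top simplex
recovers `φ` (`eq_of_incl_of_section`); neither use needs `φ` to be invertible or compatible with
`τ`. -/
theorem semidirectTransport_comp (h : IsRegularSplitExtension ι τ σ) {ρ : H ⟶ bar (Aut M)}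
    {φ : semidirect ρ ⟶ E} (hι : semidirectIncl ρ ≫ φ = ι) (hσ : semidirectSection ρ ≫ φ = σ)
    {n : ℕ} (b : H _⦋n⦌) :
    semidirectTransport ρ b ≫ φ = ((h.fibreAut b 0).inv ⊗ₘ 𝟙 _) ≫ h.transport b := by
  apply h.hom_ext_of_section 0
  · rw [← Category.assoc, inclAt_semidirectTransport, Category.assoc, hι]
    have e1 : inclAt M 0 ≫ ((h.fibreAut b 0).inv ⊗ₘ 𝟙 _) ≫ h.transport b =
        (h.fibreAut b 0).inv ≫ inclAt M 0 ≫ h.transport b := rfl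
    rw [e1, inclAt_transport]
    have e2 : (h.fibreAut b 0).inv ≫ h.fibreMap b 0 = 𝟙 M := (h.fibreAut b 0).inv_hom_id
    have e3 : (actProd ρ (n := op ⦋n⦌) b 0).inv = 𝟙 M :=
      congrArg Iso.inv (actProd_zero ρ (n := op ⦋n⦌) b)
    rw [← Category.assoc, e2]
    exact congrArg (fun f => f ≫ ι) e3
  · rw [ap_comp, ap_semidirectTransport_top, ap_tensor_comp, app_oneSimplex, NatTrans.id_app]
    refine Eq.trans ?_ (h.ap_transport_one b).symm
    exact congrArg (fun f => f.app _ b) hσ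

theorem actProd_eq (h : IsRegularSplitExtension ι τ σ) {ρ : H ⟶ bar (Aut M)}
    {φ : semidirect ρ ⟶ E} (hι : semidirectIncl ρ ≫ φ = ι) (hσ : semidirectSection ρ ≫ φ = σ)
    {n : ℕ} (b : H _⦋n⦌) (k : Fin (n + 1)) :
    actProd ρ (n := op ⦋n⦌) b k = h.fibreAut b 0 * (h.fibreAut b k)⁻¹ := by
  have e := congrArg (fun G => inclAt M k ≫ G) (h.semidirectTransport_comp hι hσ b)
  rw [← Category.assoc, inclAt_semidirectTransport, Category.assoc, hι] at e
  have e1 : inclAt M k ≫ ((h.fibreAut b 0).inv ⊗ₘ 𝟙 _) ≫ h.transport b =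
      (h.fibreAut b 0).inv ≫ inclAt M k ≫ h.transport b := rfl
  rw [e1, inclAt_transport, ← Category.assoc] at e
  have e2 : (actProd ρ (n := op ⦋n⦌) b k)⁻¹ = h.fibreAut b k * (h.fibreAut b 0)⁻¹ :=
    Iso.ext (h.extension.hom_ext e)
  rw [← inv_inj, e2, mul_inv_rev, inv_inv]

theorem eq_action (h : IsRegularSplitExtension ι τ σ) {ρ : H ⟶ bar (Aut M)}
    {φ : semidirect ρ ⟶ E} (hι : semidirectIncl ρ ≫ φ = ι) (hσ : semidirectSection ρ ≫ φ = σ) :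
    ρ = h.action := by
  refine hom_ext_app fun m b => ?_
  obtain ⟨n⟩ := m
  induction n using SimplexCategory.rec with | _ n =>
  exact bar_ext fun k => (h.actProd_eq hι hσ b k).trans (h.actProd_action b k).symm

theorem eq_of_incl_of_section (h : IsRegularSplitExtension ι τ σ) {ρ : H ⟶ bar (Aut M)}
    {φ φ' : semidirect ρ ⟶ E} (hι : semidirectIncl ρ ≫ φ = ι) (hσ : semidirectSection ρ ≫ φ = σ)
    (hι' : semidirectIncl ρ ≫ φ' = ι) (hσ' : semidirectSection ρ ≫ φ' = σ) : φ = φ' := by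
  refine hom_ext_app fun m p => ?_
  obtain ⟨n⟩ := m
  induction n using SimplexCategory.rec with | _ n =>
  obtain ⟨x, b⟩ := p
  have e := (h.semidirectTransport_comp hι hσ b).trans (h.semidirectTransport_comp hι' hσ' b).symm
  have e' := congrArg (fun G => ap G x (topSimplex n)) e
  rw [ap_comp, ap_comp, ap_semidirectTransport_top] at e'
  exact e'

end IsRegularSplitExtension

end

end PartialGroups

theorem lemma5p3 {M E H : SSet.{u}} [PartialGroups.IsPartialGroup M]
    [PartialGroups.IsPartialGroup H] (ι : M ⟶ E) (τ : E ⟶ H) (σ : H ⟶ E)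
    (hσ : PartialGroups.IsRegularSplitExtension ι τ σ) :
    ∃ ρ : H ⟶ PartialGroups.bar (Aut M),
      PartialGroups.IsRegularSplitExtension (PartialGroups.semidirectIncl ρ)
        (PartialGroups.semidirectProj ρ) (PartialGroups.semidirectSection ρ) ∧
      (∃! φ : PartialGroups.semidirect ρ ≅ E,
        PartialGroups.IsSplitExtensionIso (PartialGroups.semidirectIncl ρ)
          (PartialGroups.semidirectProj ρ) (PartialGroups.semidirectSection ρ) ι τ σ φ) ∧
      ∀ ρ' : H ⟶ PartialGroups.bar (Aut M),
        (∃ φ : PartialGroups.semidirect ρ' ≅ E,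
          PartialGroups.IsSplitExtensionIso (PartialGroups.semidirectIncl ρ')
            (PartialGroups.semidirectProj ρ') (PartialGroups.semidirectSection ρ') ι τ σ φ) →
        ρ' = ρ := by
  refine ⟨hσ.action, hσ.isSplitExtensionIso_compareIso.isRegularSplitExtension hσ,
    ⟨hσ.compareIso, hσ.isSplitExtensionIso_compareIso, fun φ hφ => Iso.ext ?_⟩,
    fun ρ' ⟨φ, hφ⟩ => hσ.eq_action hφ.incl hφ.sect⟩
  exact hσ.eq_of_incl_of_section hφ.incl hφ.sect hσ.isSplitExtensionIso_compareIso.incl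
    hσ.isSplitExtensionIso_compareIso.sect
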